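/- Let $V$ be a finite-dimensional real vector space, $g$ a non-degenerate symmetric bilinear form on $V$ (of any signature), and $A:V\to V$ a $g$-symmetric operator, $g(Au,v)=g(u,Av)$. Let $\mathrm{so}(g)$ be the Lie algebra of $g$-skew-symmetric operators and $\mathfrak g_A=\{Y\in \mathrm{so}(g) : YA=AY\}$ the centraliser of $A$ in it. Identify $\Lambda^2V$ with $\mathrm{so}(g)$ by $u\wedge v\mapsto u\otimes g(v)-v\otimes g(u)$, i.e. $(u\wedge v)w=g(v,w)u-g(u,w)v$. A linear map $R:\Lambda^2V\to \mathrm{gl}(V)$ is a formal curvature tensor if $R(u\wedge v)w+R(v\wedge w)u+R(w\wedge u)v=0$ for all $u,v,w\in V$. A Lie subalgebra $\mathfrak h\subset \mathrm{gl}(V)$ is a Berger algebra if it is spanned, as a vector space, by the operators $R(u\wedge v)$, where $u,v\in V$ and $R$ runs over the formal curvature tensors with image in $\mathfrak h$. The space $V$ has a $g$-orthogonal decomposition $V=\bigoplus_{\alpha=1}^s V_\alpha$ into $A$-invariant subspaces such that each $A|_{V_\alpha}$ is given, in some basis of $V_\alpha$, by a single non-empty real Jordan block (either with one real eigenvalue,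 or the real Jordan block of a pair of non-real complex conjugate eigenvalues). Given any such decomposition and $\alpha\le\beta$, put $V_{\alpha\beta}=V_\alpha+V_\beta$ (so $V_{\alpha\alpha}=V_\alpha$), $A_{\alpha\beta}=A|_{V_{\alpha\beta}}$, let $p_{\alpha\beta}$ be the minimal polynomial of $A_{\alpha\beta}$, and let $$R_{\alpha\beta}(X)=\frac{d}{dt}\Big|_{t=0}p_{\alpha\beta}(A_{\alpha\beta}+tX),\qquad X\in \mathrm{so}(g,V_{\alpha\beta}),$$ where $\mathrm{so}(g,V_{\alpha\beta})$ is the space of $g$-skew-symmetric operators on $V_{\alpha\beta}$, considered as operators on $V$ that vanish on the other $V_\gamma$. Extend $R_{\alpha\beta}$ to a linear map $\mathrm{so}(g)\to\mathrm{so}(g)$ by zero on the natural complement of $\mathrm{so}(g,V_{\alpha\beta})$, the space of all $X\in\mathrm{so}(g)$ whose diagonal block on $V_{\alpha\beta}$ vanishes. Put $$R_{\mathrm{formal}}=\sum_{\alpha\le\beta}R_{\alpha\beta}:\mathrm{so}(g)\to\mathrm{so}(g).$$ Then, for every such decomposition, $R_{\mathrm{formal}}$, regarded as a map on $\Lambda^2V\simeq\mathrm{so}(g)$,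 is a formal curvature tensor, and its image is exactly $\mathfrak g_A$. In particular, $\mathfrak g_A$ is a Berger algebra. -/

import Mathlib

open Polynomial

attribute [local instance 100] LieRing.ofAssociativeRing

namespace BergerTest

noncomputable section

/-! ### `so(g)`, the centraliser `g_A`, and the identification `Λ²V ≃ so(g)` -/

/-- `so(g)`: the Lie algebra of `g`-skew-symmetric operators. -/
abbrev so {V : Type*} [AddCommGroup V] [Module ℝ V] (g : LinearMap.BilinForm ℝ V) :
    LieSubalgebra ℝ (Module.End ℝ V) :=
  skewAdjointLieSubalgebra g

theorem mem_so {V : Type*} [AddCommGroup V] [Module ℝ V] (g : LinearMap.BilinForm ℝ V)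
    (X : Module.End ℝ V) : X ∈ so g ↔ ∀ u v, g (X u) v = -g u (X v) := by
  have h : X ∈ so g ↔ X ∈ g.skewAdjointSubmodule := Iff.rfl
  rw [h, LinearMap.mem_skewAdjointSubmodule]
  simp [LinearMap.IsSkewAdjoint, LinearMap.IsAdjointPair]

/-- `g_A = {Y ∈ so(g) | [Y, A] = 0}`: the centraliser of `A` in `so(g)`. -/
def centraliser {V : Type*} [AddCommGroup V] [Module ℝ V] (g : LinearMap.BilinForm ℝ V)
    (A : Module.End ℝ V) : LieSubalgebra ℝ (Module.End ℝ V) where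
  carrier := {Y | Y ∈ so g ∧ ⁅Y, A⁆ = 0}
  zero_mem' := ⟨(so g).zero_mem, by simp⟩
  add_mem' := fun hX hY => ⟨(so g).add_mem hX.1 hY.1, by rw [add_lie, hX.2, hY.2, add_zero]⟩
  smul_mem' := fun c X hX => ⟨(so g).smul_mem c hX.1, by
    have h := hX.2
    rw [LieRing.of_associative_ring_bracket] at h ⊢
    rw [smul_mul_assoc, mul_smul_comm, ← smul_sub, h, smul_zero]⟩
  lie_mem' := fun {X Y} hX hY => ⟨(so g).lie_mem hX.1 hY.1, by
    rw [lie_lie, hX.2, hY.2, lie_zero, lie_zero, sub_zero]⟩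

/-- The operator `u ⊗ g(v) - v ⊗ g(u)`, that is, `w ↦ g(v, w) u - g(u, w) v`. -/
def wedgeOp {V : Type*} [AddCommGroup V] [Module ℝ V] (g : LinearMap.BilinForm ℝ V)
    (u v : V) : Module.End ℝ V :=
  (g v).smulRight u - (g u).smulRight v

theorem wedgeOp_apply {V : Type*} [AddCommGroup V] [Module ℝ V] (g : LinearMap.BilinForm ℝ V)
    (u v w : V) : wedgeOp g u v w = g v w • u - g u w • v := by
  simp [wedgeOp]

theorem wedgeOp_mem_so {V : Type*} [AddCommGroup V] [Module ℝ V] (g : LinearMap.BilinForm ℝ V)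
    (hg : g.IsSymm) (u v : V) : wedgeOp g u v ∈ so g := by
  rw [mem_so]
  intro x y
  simp only [wedgeOp_apply, map_sub, map_smul, LinearMap.sub_apply, LinearMap.smul_apply,
    smul_eq_mul]
  rw [hg.eq x u, hg.eq x v]
  ring

/-- The alternating bilinear map `(u, v) ↦ u ⊗ g(v) - v ⊗ g(u)` with values in `so(g)`. -/
def wedgeAlt {V : Type*} [AddCommGroup V] [Module ℝ V] (g : LinearMap.BilinForm ℝ V)
    (hg : g.IsSymm) : V [⋀^Fin 2]→ₗ[ℝ] so g where
  toFun m := ⟨wedgeOp g (m 0) (m 1), wedgeOp_mem_so g hg _ _⟩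
  map_update_add' := by
    intro _ m i x y
    apply Subtype.ext
    ext w
    fin_cases i <;> simp [wedgeOp_apply, add_smul] <;> abel
  map_update_smul' := by
    intro _ m i c x
    apply Subtype.ext
    ext w
    fin_cases i <;> simp [wedgeOp_apply, mul_smul, smul_sub] <;> rw [smul_comm]
  map_eq_zero_of_eq' := by
    intro m i j hij hne
    apply Subtype.ext
    ext w
    fin_cases i <;> fin_cases j <;> simp_all [wedgeOp_apply]

/-- The identification `Λ²V → so(g)`, `u ∧ v ↦ u ⊗ g(v) - v ⊗ g(u)`. -/
def wedgeToSo {V : Type*} [AddCommGroup V] [Module ℝ V] (g : LinearMap.BilinForm ℝ V)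
    (hg : g.IsSymm) : ⋀[ℝ]^2 V →ₗ[ℝ] so g :=
  exteriorPower.alternatingMapLinearEquiv (wedgeAlt g hg)

theorem wedgeToSo_wedge {V : Type*} [AddCommGroup V] [Module ℝ V]
    (g : LinearMap.BilinForm ℝ V) (hg : g.IsSymm) (u v : V) :
    (wedgeToSo g hg (exteriorPower.ιMulti ℝ 2 ![u, v]) : Module.End ℝ V) = wedgeOp g u v := by
  simp [wedgeToSo, wedgeAlt]

/-- `Λ²V → so(g)` is an isomorphism. -/
theorem wedgeToSo_bijective {V : Type*} [AddCommGroup V] [Module ℝ V] [FiniteDimensional ℝ V]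
    (g : LinearMap.BilinForm ℝ V) (hg : g.IsSymm) (hnd : g.Nondegenerate) :
    Function.Bijective (wedgeToSo g hg) := by
  classical
  let b := Module.finBasis ℝ V
  let d := g.dualBasis hnd b
  have hd : ∀ x, ∑ i, g x (b i) • d i = x := fun x => by
    conv_rhs => rw [← d.sum_repr x]
    simp [d]
  have hb : ∀ x, ∑ i, g x (d i) • b i = x := fun x => by
    conv_rhs => rw [← b.sum_repr x]
    refine Finset.sum_congr rfl fun i _ => ?_
    congr 1
    have h : g x (d i) = g (∑ j, b.repr x j • b j) (d i) := by rw [b.sum_repr]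
    rw [h]
    simp only [map_sum, LinearMap.sum_apply, map_smul, LinearMap.smul_apply, d,
      LinearMap.BilinForm.apply_dualBasis_right hnd hg]
    simp
  let ι2 := exteriorPower.ιMulti ℝ 2 (M := V)
  let inv : so g → ⋀[ℝ]^2 V := fun X => (2⁻¹ : ℝ) • ∑ i, ι2 ![X.1 (b i), d i]
  have hadd1 : ∀ x y z : V, ι2 ![x + y, z] = ι2 ![x, z] + ι2 ![y, z] := fun x y z => by
    have h := ι2.map_update_add ![x, z] 0 x y
    have e : ∀ t : V, Function.update ![x, z] 0 t = ![t, z] := fun t => by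
      ext i; fin_cases i <;> simp
    rwa [e, e, e] at h
  have hsmul1 : ∀ (c : ℝ) (x z : V), ι2 ![c • x, z] = c • ι2 ![x, z] := fun c x z => by
    have h := ι2.map_update_smul ![x, z] 0 c x
    have e : ∀ t : V, Function.update ![x, z] 0 t = ![t, z] := fun t => by
      ext i; fin_cases i <;> simp
    rwa [e, e] at h
  have hswap : ∀ x y : V, ι2 ![y, x] = -ι2 ![x, y] := fun x y => by
    have h := ι2.map_swap ![x, y] (i := 0) (j := 1) (by simp)
    rw [← h]
    congr 1
    ext i
    fin_cases i <;> simp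
  have hL : ∀ z : V, ∃ L : V →ₗ[ℝ] ⋀[ℝ]^2 V, ∀ x, L x = ι2 ![z, x] := fun z =>
    ⟨-{ toFun := fun x => ι2 ![x, z], map_add' := fun x y => hadd1 x y z,
        map_smul' := fun c x => hsmul1 c x z }, fun x => by simp [hswap x z]⟩
  have hleft : ∀ u v, (∑ i, ι2 ![wedgeOp g u v (b i), d i]) = (2 : ℝ) • ι2 ![u, v] := by
    intro u v
    have key : ∀ z x : V, ∑ i, ι2 ![g x (b i) • z, d i] = ι2 ![z, x] := by
      intro z x
      obtain ⟨L, hLz⟩ := hL z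
      simp only [hsmul1]
      simp only [← hLz, ← map_smul, ← map_sum, hd]
    have h1 : ∀ i, ι2 ![wedgeOp g u v (b i), d i] =
        ι2 ![g v (b i) • u, d i] - ι2 ![g u (b i) • v, d i] := fun i => by
      rw [wedgeOp_apply, sub_eq_add_neg, ← neg_smul, hadd1, hsmul1 (-(g u (b i))),
        hsmul1 (g u (b i)), sub_eq_add_neg]
      congr 1
      exact neg_smul (g u (b i)) (ι2 ![v, d i])
    rw [Finset.sum_congr rfl fun i _ => h1 i, Finset.sum_sub_distrib, key, key, hswap u v,
      sub_neg_eq_add, two_smul]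
  have hinvL : ∃ L : so g →ₗ[ℝ] ⋀[ℝ]^2 V, ∀ X, L X = inv X :=
    ⟨{ toFun := inv
       map_add' := fun X Y => by
         simp only [inv, ← smul_add, ← Finset.sum_add_distrib]
         congr 1
         refine Finset.sum_congr rfl fun i _ => ?_
         rw [← hadd1]
         rfl
       map_smul' := fun c X => by
         simp only [inv, RingHom.id_apply]
         rw [smul_comm c]
         congr 1
         rw [Finset.smul_sum]
         refine Finset.sum_congr rfl fun i _ => ?_
         rw [← hsmul1]
         rfl }, fun _ => rfl⟩
  obtain ⟨L, hLinv⟩ := hinvL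
  refine Function.bijective_iff_has_inverse.mpr ⟨L, ?_, ?_⟩
  · have : L ∘ₗ wedgeToSo g hg = LinearMap.id := by
      apply exteriorPower.linearMap_ext
      ext m
      obtain ⟨u, v, rfl⟩ : ∃ u v, m = ![u, v] :=
        ⟨m 0, m 1, by ext i; fin_cases i <;> rfl⟩
      simp only [LinearMap.compAlternatingMap_apply, LinearMap.comp_apply, hLinv, inv,
        wedgeToSo_wedge, hleft, LinearMap.id_apply, ι2]
      rw [smul_smul]
      norm_num
    intro x
    exact LinearMap.congr_fun this x
  · intro X
    apply Subtype.ext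
    ext w
    have hX := (mem_so g X.1).1 X.2
    have h2 : (wedgeToSo g hg (L X) : Module.End ℝ V) =
        (2⁻¹ : ℝ) • ∑ i, wedgeOp g (X.1 (b i)) (d i) := by
      rw [hLinv]
      simp only [inv, map_smul, map_sum, ι2]
      simp [wedgeToSo_wedge]
    rw [h2]
    simp only [LinearMap.smul_apply, LinearMap.sum_apply, wedgeOp_apply,
      Finset.sum_sub_distrib]
    have e1 : ∑ i, g (d i) w • X.1 (b i) = X.1 w := by
      simp only [hg.eq _ w, ← map_smul, ← map_sum, hb]
    have e2 : ∑ i, g (X.1 (b i)) w • d i = -X.1 w := by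
      have : ∀ i, g (X.1 (b i)) w • d i = -(g (X.1 w) (b i) • d i) := fun i => by
        rw [hX, hg.eq (b i), neg_smul]
      rw [Finset.sum_congr rfl fun i _ => this i, Finset.sum_neg_distrib, hd]
    rw [e1, e2, sub_neg_eq_add, ← two_smul ℝ, smul_smul]
    norm_num

/-! ### Formal curvature tensors and Berger algebras -/

/-- A linear map `R : Λ²V → gl(V)` satisfying the Bianchi identity. -/
def IsFormalCurvatureTensor {V : Type*} [AddCommGroup V] [Module ℝ V]
    (R : ⋀[ℝ]^2 V →ₗ[ℝ] Module.End ℝ V) : Prop :=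
  ∀ u v w : V,
    R (exteriorPower.ιMulti ℝ 2 ![u, v]) w + R (exteriorPower.ιMulti ℝ 2 ![v, w]) u +
      R (exteriorPower.ιMulti ℝ 2 ![w, u]) v = 0

/-- `h ⊆ gl(V)` is a Berger algebra if it is spanned by the operators `R(u ∧ v)`, where `R` runs
over the formal curvature tensors with image in `h`. -/
def IsBerger {V : Type*} [AddCommGroup V] [Module ℝ V]
    (h : LieSubalgebra ℝ (Module.End ℝ V)) : Prop :=
  h.toSubmodule = Submodule.span ℝ
    {Y | ∃ R : ⋀[ℝ]^2 V →ₗ[ℝ] Module.End ℝ V, IsFormalCurvatureTensor R ∧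
      LinearMap.range R ≤ h.toSubmodule ∧
      ∃ u v : V, R (exteriorPower.ιMulti ℝ 2 ![u, v]) = Y}

/-! ### The derivative `d/dt p(A + tX)` at `t = 0` -/

/-- For `p = ∑ aₘ tᵐ`, the linear map `X ↦ d/dt p(A + tX)|_{t = 0}`, that is,
`X ↦ ∑ₘ aₘ ∑_{j < m} A^{m-1-j} X A^j`; see `hasDerivAt_polyDeriv`. -/
def polyDeriv {W : Type*} [AddCommGroup W] [Module ℝ W] (p : ℝ[X]) (A : Module.End ℝ W) :
    Module.End ℝ W →ₗ[ℝ] Module.End ℝ W :=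
  ∑ m ∈ p.support, p.coeff m • ∑ j ∈ Finset.range m,
    LinearMap.mulLeft ℝ (A ^ (m - 1 - j)) ∘ₗ LinearMap.mulRight ℝ (A ^ j)

theorem polyDeriv_apply {W : Type*} [AddCommGroup W] [Module ℝ W] (p : ℝ[X])
    (A X : Module.End ℝ W) :
    polyDeriv p A X = ∑ m ∈ p.support, p.coeff m • ∑ j ∈ Finset.range m,
      A ^ (m - 1 - j) * X * A ^ j := by
  simp [polyDeriv, LinearMap.sum_apply, mul_assoc]

/-- `polyDeriv p A X` is the derivative of `t ↦ p(A + tX)` at `t = 0`, tested against every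
linear functional on `End(W)`. -/
theorem hasDerivAt_polyDeriv {W : Type*} [AddCommGroup W] [Module ℝ W] (p : ℝ[X])
    (A X : Module.End ℝ W) (φ : Module.Dual ℝ (Module.End ℝ W)) :
    HasDerivAt (fun t : ℝ => φ (aeval (A + t • X) p)) (φ (polyDeriv p A X)) 0 := by
  have mono : ∀ (m : ℕ) (ψ : Module.Dual ℝ (Module.End ℝ W)),
      HasDerivAt (fun t : ℝ => ψ ((A + t • X) ^ m))
        (ψ (∑ j ∈ Finset.range m, A ^ (m - 1 - j) * X * A ^ j)) 0 := by
    intro m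
    induction m with
    | zero => intro ψ; simpa using hasDerivAt_const (0 : ℝ) (ψ 1)
    | succ m ih =>
      intro ψ
      have h1 := ih (ψ ∘ₗ LinearMap.mulRight ℝ A)
      have h2 := (hasDerivAt_id (0 : ℝ)).mul (ih (ψ ∘ₗ LinearMap.mulRight ℝ X))
      convert! h1.add h2 using 1
      · ext t
        simp [pow_succ, mul_add]
      · have h3 : ∀ j ∈ Finset.range m, A ^ (m - (j + 1)) * X * A ^ (j + 1) =
            A ^ (m - 1 - j) * X * A ^ j * A := fun j _ => by
          rw [pow_succ, ← mul_assoc, Nat.sub_sub, Nat.add_comm 1 j]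
        rw [Finset.sum_range_succ']
        simp only [Nat.add_sub_cancel, Finset.sum_congr rfl h3]
        simp
  have h : (fun t : ℝ => φ (aeval (A + t • X) p)) =
      fun t => ∑ m ∈ p.support, p.coeff m * φ ((A + t • X) ^ m) := by
    ext t
    rw [aeval_eq_sum_range, ← Polynomial.sum_over_range p (f := fun m a => a • (A + t • X) ^ m)
      (by simp), Polynomial.sum_def]
    simp
  rw [h, polyDeriv_apply, map_sum]
  simp only [map_smul, smul_eq_mul]
  exact HasDerivAt.fun_sum fun m _ => (mono m φ).const_mul _

theorem polyDeriv_skew {W : Type*} [AddCommGroup W] [Module ℝ W] (h : LinearMap.BilinForm ℝ W)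
    (p : ℝ[X]) (A X : Module.End ℝ W) (hA : ∀ x y, h (A x) y = h x (A y))
    (hX : ∀ x y, h (X x) y = -h x (X y)) (x y : W) :
    h (polyDeriv p A X x) y = -h x (polyDeriv p A X y) := by
  have hpow : ∀ (n : ℕ) (x y : W), h ((A ^ n) x) y = h x ((A ^ n) y) := by
    intro n
    induction n with
    | zero => simp
    | succ n ih =>
      intro x y
      rw [pow_succ, Module.End.mul_apply, ih, hA, ← Module.End.mul_apply, ← pow_succ', pow_succ]
  have hterm : ∀ m, h ((∑ j ∈ Finset.range m, A ^ (m - 1 - j) * X * A ^ j) x) y =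
      -h x ((∑ j ∈ Finset.range m, A ^ (m - 1 - j) * X * A ^ j) y) := by
    intro m
    conv_rhs => rw [← Finset.sum_range_reflect]
    simp only [LinearMap.sum_apply, map_sum, ← Finset.sum_neg_distrib]
    refine Finset.sum_congr rfl fun j hj => ?_
    have hj' : m - 1 - (m - 1 - j) = j := by
      have := Finset.mem_range.1 hj
      omega
    rw [hj']
    simp only [Module.End.mul_apply]
    rw [hpow, hX, hpow]
  rw [polyDeriv_apply]
  simp only [LinearMap.sum_apply, LinearMap.smul_apply, map_sum, map_smul, smul_eq_mul,
    ← Finset.sum_neg_distrib]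
  refine Finset.sum_congr rfl fun m _ => ?_
  have := hterm m
  simp only [LinearMap.sum_apply, map_sum] at this
  rw [this, mul_neg]

/-! ### Real Jordan blocks and orthogonal Jordan decompositions -/

/-- The `n × n` Jordan block with real eigenvalue `c`. -/
def jordanMatrix (n : ℕ) (c : ℝ) : Matrix (Fin n) (Fin n) ℝ :=
  Matrix.of fun i j => if i = j then c else if i.val + 1 = j.val then 1 else 0

/-- The `2n × 2n` real Jordan block with complex conjugate eigenvalues `a ± ib`: its diagonal
`2 × 2` blocks are `!![a, b; -b, a]` and those just above the diagonal are identity matrices. -/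
def realJordanMatrix (n : ℕ) (a b : ℝ) : Matrix (Fin n × Fin 2) (Fin n × Fin 2) ℝ :=
  Matrix.of fun i j =>
    if i.1 = j.1 then !![a, b; -b, a] i.2 j.2
    else if i.1.val + 1 = j.1.val ∧ i.2 = j.2 then 1 else 0

/-- In some basis of `W` the operator `f` is given by one non-empty real Jordan block (with a real
eigenvalue or with a pair of non-real complex conjugate ones). -/
def IsJordanBlock {W : Type*} [AddCommGroup W] [Module ℝ W] (f : Module.End ℝ W) : Prop :=
  (∃ (n : ℕ) (c : ℝ) (e : Module.Basis (Fin n) ℝ W),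
      0 < n ∧ LinearMap.toMatrix e e f = jordanMatrix n c) ∨
  (∃ (n : ℕ) (a b : ℝ) (e : Module.Basis (Fin n × Fin 2) ℝ W),
      0 < n ∧ b ≠ 0 ∧ LinearMap.toMatrix e e f = realJordanMatrix n a b)

/-- A `g`-orthogonal decomposition `V = ⨁ W α` into `A`-invariant subspaces corresponding to the
Jordan blocks of `A`. -/
structure JordanDecomposition {V : Type*} [AddCommGroup V] [Module ℝ V]
    (g : LinearMap.BilinForm ℝ V) (A : Module.End ℝ V) where
  /-- the number of blocks -/
  s : ℕ
  /-- the subspaces -/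
  W : Fin s → Submodule ℝ V
  isInternal : DirectSum.IsInternal W
  orthogonal : ∀ α β, α ≠ β → ∀ x ∈ W α, ∀ y ∈ W β, g x y = 0
  invariant : ∀ α, ∀ x ∈ W α, A x ∈ W α
  isJordanBlock : ∀ α, IsJordanBlock (A.restrict (invariant α))

namespace JordanDecomposition

variable {V : Type*} [AddCommGroup V] [Module ℝ V] {g : LinearMap.BilinForm ℝ V}
  {A : Module.End ℝ V} (D : JordanDecomposition g A)

/-- `V_α + V_β` (which is `V_α` if `α = β`). -/
def pair (α β : Fin D.s) : Submodule ℝ V := D.W α ⊔ D.W β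

/-- The sum of all the remaining blocks. -/
def rest (α β : Fin D.s) : Submodule ℝ V := ⨆ γ ∈ {γ : Fin D.s | γ ≠ α ∧ γ ≠ β}, D.W γ

theorem isCompl_pair_rest (α β : Fin D.s) : IsCompl (D.pair α β) (D.rest α β) := by
  have hp : D.pair α β = ⨆ γ ∈ ({α, β} : Set (Fin D.s)), D.W γ := by
    rw [iSup_pair, pair]
  constructor
  · rw [hp, rest]
    refine D.isInternal.submodule_iSupIndep.disjoint_biSup_biSup ?_
    rw [Set.disjoint_left]
    rintro γ (rfl | rfl) ⟨h1, h2⟩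
    · exact h1 rfl
    · exact h2 rfl
  · rw [codisjoint_iff, eq_top_iff, ← D.isInternal.submodule_iSup_eq_top, hp, rest]
    refine iSup_le fun γ => ?_
    by_cases h : γ ∈ ({α, β} : Set (Fin D.s))
    · exact le_sup_of_le_left (le_biSup D.W h)
    · refine le_sup_of_le_right (le_biSup D.W ?_)
      simpa [not_or] using h

theorem pair_invariant (α β : Fin D.s) : ∀ x ∈ D.pair α β, A x ∈ D.pair α β := by
  intro x hx
  obtain ⟨y, hy, z, hz, rfl⟩ := Submodule.mem_sup.1 hx
  rw [map_add]
  exact Submodule.add_mem_sup (D.invariant α y hy) (D.invariant β z hz)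

theorem pair_rest_orthogonal (α β : Fin D.s) (x : V) (hx : x ∈ D.pair α β) (y : V)
    (hy : y ∈ D.rest α β) : g x y = 0 ∧ g y x = 0 := by
  obtain ⟨u, hu, v, hv, rfl⟩ := Submodule.mem_sup.1 hx
  have h : D.rest α β ≤
      LinearMap.ker (g u) ⊓ LinearMap.ker (g v) ⊓
        (LinearMap.ker (g.flip u) ⊓ LinearMap.ker (g.flip v)) := by
    refine iSup₂_le fun γ hγ z hz => ?_
    simp only [Submodule.mem_inf, LinearMap.mem_ker]
    exact ⟨⟨D.orthogonal α γ (Ne.symm hγ.1) u hu z hz, D.orthogonal β γ (Ne.symm hγ.2) v hv z hz⟩,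
      D.orthogonal γ α hγ.1 z hz u hu, D.orthogonal γ β hγ.2 z hz v hv⟩
  have h' := h hy
  simp only [Submodule.mem_inf, LinearMap.mem_ker] at h'
  obtain ⟨⟨h1, h2⟩, h3, h4⟩ := h'
  change g y u = 0 at h3
  change g y v = 0 at h4
  simp [h1, h2, h3, h4]

/-- The `g`-orthogonal projection of `V` onto `V_α + V_β`. -/
def proj (α β : Fin D.s) : V →ₗ[ℝ] D.pair α β :=
  Submodule.projectionOnto (D.pair α β) (D.rest α β) (D.isCompl_pair_rest α β)

/-- The restriction of `A` to `V_α + V_β`. -/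
def pairOp (α β : Fin D.s) : Module.End ℝ (D.pair α β) :=
  A.restrict (D.pair_invariant α β)

/-- The diagonal block on `V_α + V_β` of an operator on `V`. On `so(g)` this is the projection to
`so(g, V_α + V_β)` along its natural complement, the space of skew-symmetric operators for which
this block vanishes. -/
def compress (α β : Fin D.s) : Module.End ℝ V →ₗ[ℝ] Module.End ℝ (D.pair α β) :=
  (LinearMap.compRight ℝ (D.proj α β)) ∘ₗ LinearMap.lcomp ℝ V (D.pair α β).subtype

/-- Extension by zero of an operator on `V_α + V_β` to an operator on `V`. -/
def extend (α β : Fin D.s) : Module.End ℝ (D.pair α β) →ₗ[ℝ] Module.End ℝ V :=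
  (LinearMap.compRight ℝ (D.pair α β).subtype) ∘ₗ LinearMap.lcomp ℝ (D.pair α β) (D.proj α β)

theorem compress_apply (α β : Fin D.s) (X : Module.End ℝ V) (x : D.pair α β) :
    D.compress α β X x = D.proj α β (X x) := rfl

theorem extend_apply (α β : Fin D.s) (Y : Module.End ℝ (D.pair α β)) (x : V) :
    D.extend α β Y x = Y (D.proj α β x) := rfl

/-- `X ↦ d/dt p(A|_{V_α + V_β} + tX)|_{t = 0}` on the block `V_α + V_β`, with `p` the minimal
polynomial of `A|_{V_α + V_β}`, extended by zero. -/
def blockOp (α β : Fin D.s) : Module.End ℝ V →ₗ[ℝ] Module.End ℝ V :=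
  D.extend α β ∘ₗ polyDeriv (minpoly ℝ (D.pairOp α β)) (D.pairOp α β) ∘ₗ D.compress α β

theorem form_proj_left (α β : Fin D.s) (x : V) (y : D.pair α β) :
    g (D.proj α β x) y = g x y := by
  have h : x - D.proj α β x ∈ D.rest α β := by
    have := Submodule.sub_projection_mem (D.isCompl_pair_rest α β) x
    rwa [Submodule.projection_apply] at this
  have h2 := (D.pair_rest_orthogonal α β y y.2 _ h).2
  rw [map_sub, LinearMap.sub_apply, sub_eq_zero] at h2
  exact h2.symm

theorem form_proj_right (α β : Fin D.s) (x : D.pair α β) (y : V) :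
    g x (D.proj α β y) = g x y := by
  have h : y - D.proj α β y ∈ D.rest α β := by
    have := Submodule.sub_projection_mem (D.isCompl_pair_rest α β) y
    rwa [Submodule.projection_apply] at this
  have h2 := (D.pair_rest_orthogonal α β x x.2 _ h).1
  rw [map_sub, sub_eq_zero] at h2
  exact h2.symm

theorem blockOp_mem_so (hA : g.IsSelfAdjoint A) (α β : Fin D.s) (X : Module.End ℝ V)
    (hX : X ∈ so g) : D.blockOp α β X ∈ so g := by
  rw [mem_so] at hX ⊢
  intro x y
  have hc : ∀ u v : D.pair α β, g.restrict (D.pair α β) (D.compress α β X u) v =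
      -g.restrict (D.pair α β) u (D.compress α β X v) := fun u v => by
    change g (D.proj α β (X u)) v = -g u (D.proj α β (X v))
    rw [form_proj_left, form_proj_right, hX]
  have hS : ∀ u v : D.pair α β, g.restrict (D.pair α β) (D.pairOp α β u) v =
      g.restrict (D.pair α β) u (D.pairOp α β v) := fun u v => hA u v
  have key := polyDeriv_skew (g.restrict (D.pair α β)) (minpoly ℝ (D.pairOp α β))
    (D.pairOp α β) (D.compress α β X) hS hc (D.proj α β x) (D.proj α β y)
  simp only [blockOp, LinearMap.comp_apply, extend_apply]
  rw [← D.form_proj_right, ← D.form_proj_left α β x]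
  exact key

/-- `R_{αβ} : so(g) → so(g)`. -/
def blockCurvature (hA : g.IsSelfAdjoint A) (α β : Fin D.s) : so g →ₗ[ℝ] so g :=
  ((D.blockOp α β).domRestrict (so g).toSubmodule).codRestrict (so g).toSubmodule
    fun X => D.blockOp_mem_so hA α β X X.2

/-- `R_formal = ∑_{α ≤ β} R_{αβ} : so(g) → so(g)`. -/
def formalCurvature (hA : g.IsSelfAdjoint A) : so g →ₗ[ℝ] so g :=
  ∑ p : Fin D.s × Fin D.s with p.1 ≤ p.2, D.blockCurvature hA p.1 p.2

end JordanDecomposition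

end

end BergerTest

/-! A Jordan block is the same thing as a cyclic operator: its space is {q(A)v}, and the annihilator
of v is generated by a power f^n of a real irreducible polynomial f. Only this is used below, so
real and complex eigenvalues are treated alike and no normal form of g is needed.

The derivative of p = ∑ a_m t^m at A is X ↦ ∑ a_m ∑ A^(m-1-j) X A^j. A map X ↦ B X C with C
self-adjoint satisfies the Bianchi identity, because g(x, Cy) is symmetric (`wedgeOp_bianchi`);
orthogonal projections commuting with A are absorbed into B and C. The commutator of the derivative
with A telescopes to X p(A) - p(A) X (`polyDeriv_mul_sub_mul`). This vanishes when p annihilates the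
block, so the image lies in the centraliser.

Conversely, cut Y in the centraliser into blocks P_α Y P_β. A diagonal block is a polynomial in a
cyclic operator, hence both self-adjoint and skew, hence zero. Blocks between different irreducibles
vanish by coprimality. If V_α, V_β belong to f^m, f^n with m ≤ n, then p_αβ = f^n. Let v generate
V_β, let N = deg f^n, and choose z in V_β with g(z, A^j v) equal to 1 for j = N-1 and to 0 for
smaller j. Only the leading term survives in R_formal(Yv ∧ z) v when Y interchanges the two blocks,
and it equals Yv. Commutation with A extends the equality to V_β, and skewness extends it to V_α
(`exists_formalCurvature_eq`).

The decomposition exists because some cyclic subspace is non-degenerate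
(`exists_form_evalAt_ne_zero`) and can be split off orthogonally. -/

namespace BergerTest

/-! ### Cyclic subspaces annihilated by a power of an irreducible polynomial -/

/-- The map `q ↦ q(A) v`. -/
noncomputable def evalAt {W : Type*} [AddCommGroup W] [Module ℝ W] (A : Module.End ℝ W) (v : W) :
    ℝ[X] →ₗ[ℝ] W :=
  LinearMap.applyₗ v ∘ₗ (aeval A).toLinearMap

theorem evalAt_apply {W : Type*} [AddCommGroup W] [Module ℝ W] (A : Module.End ℝ W) (v : W)
    (q : ℝ[X]) : evalAt A v q = aeval A q v := rfl

theorem evalAt_mul {W : Type*} [AddCommGroup W] [Module ℝ W] (A : Module.End ℝ W) (v : W)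
    (p q : ℝ[X]) : evalAt A v (p * q) = aeval A p (evalAt A v q) := by
  simp [evalAt_apply]

/-- The annihilator of `v` in `ℝ[X]`, acting through `A`, is generated by `f ^ n`, where `f` is
monic and irreducible and `0 < n`. -/
structure IsPrimaryVector {W : Type*} [AddCommGroup W] [Module ℝ W] (A : Module.End ℝ W)
    (f : ℝ[X]) (n : ℕ) (v : W) : Prop where
  irreducible : Irreducible f
  monic : f.Monic
  pos : 0 < n
  ker : ∀ q, evalAt A v q = 0 ↔ f ^ n ∣ q

/-- The gcd of q and f^n is some f^k with k < n, so Bézout expresses its multiple f^(n-1) through q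
and f^n. Hence every non-zero vector of a primary cyclic subspace has f^(n-1)(A)v among its
multiples. -/
theorem exists_pow_dvd_mul_sub {f q : ℝ[X]} {n : ℕ} (hf : Irreducible f)
    (hq : ¬ f ^ n ∣ q) : ∃ a, f ^ n ∣ a * q - f ^ (n - 1) := by
  have hdvd : EuclideanDomain.gcd q (f ^ n) ∣ f ^ n := EuclideanDomain.gcd_dvd_right _ _
  obtain ⟨k, hk, hassoc⟩ := (dvd_prime_pow hf.prime n).1 hdvd
  have hkn : k ≤ n - 1 := by
    by_contra h
    have : k = n := by omega
    subst this
    exact hq (hassoc.symm.dvd.trans (EuclideanDomain.gcd_dvd_left _ _))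
  obtain ⟨c, hc⟩ := hassoc.dvd.trans (pow_dvd_pow f hkn)
  refine ⟨c * EuclideanDomain.gcdA q (f ^ n), -(EuclideanDomain.gcdB q (f ^ n) * c), ?_⟩
  rw [hc]
  linear_combination (-c) * EuclideanDomain.gcd_eq_gcd_ab q (f ^ n)

theorem IsPrimaryVector.of_apply {W : Type*} [AddCommGroup W] [Module ℝ W] {A : Module.End ℝ W}
    {f : ℝ[X]} {n : ℕ} {v : W} (hf : Irreducible f) (hm : f.Monic) (hn : 0 < n)
    (h0 : evalAt A v (f ^ n) = 0) (h1 : evalAt A v (f ^ (n - 1)) ≠ 0) :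
    IsPrimaryVector A f n v := by
  have hdvd : ∀ q, f ^ n ∣ q → evalAt A v q = 0 := by
    rintro _ ⟨c, rfl⟩
    rw [mul_comm, evalAt_mul, h0, map_zero]
  refine ⟨hf, hm, hn, fun q => ⟨fun hq => ?_, hdvd q⟩⟩
  by_contra hnd
  obtain ⟨a, ha⟩ := exists_pow_dvd_mul_sub hf hnd
  have := hdvd _ ha
  rw [map_sub, evalAt_mul, hq, map_zero, zero_sub, neg_eq_zero] at this
  exact h1 this

namespace IsPrimaryVector

variable {W : Type*} [AddCommGroup W] [Module ℝ W] {A : Module.End ℝ W} {f : ℝ[X]} {n : ℕ} {v : W}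

theorem evalAt_pow_self (h : IsPrimaryVector A f n v) : evalAt A v (f ^ n) = 0 :=
  (h.ker _).2 dvd_rfl

theorem range_eq_map_degreeLT (h : IsPrimaryVector A f n v) :
    (degreeLT ℝ (f ^ n).natDegree).map (evalAt A v) = LinearMap.range (evalAt A v) := by
  refine le_antisymm (LinearMap.map_le_range) ?_
  rintro _ ⟨q, rfl⟩
  have hm := h.monic.pow n
  refine ⟨q %ₘ f ^ n, ?_, ?_⟩
  · rw [SetLike.mem_coe, mem_degreeLT, ← degree_eq_natDegree hm.ne_zero]
    exact degree_modByMonic_lt _ hm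
  · conv_rhs => rw [← modByMonic_add_div q (f ^ n)]
    rw [map_add, mul_comm, evalAt_mul, h.evalAt_pow_self, map_zero, add_zero]

theorem finrank_range (h : IsPrimaryVector A f n v) :
    Module.finrank ℝ (LinearMap.range (evalAt A v)) = (f ^ n).natDegree := by
  rw [← h.range_eq_map_degreeLT, ← Submodule.range_subtype (degreeLT ℝ (f ^ n).natDegree),
    ← LinearMap.range_comp, LinearMap.finrank_range_of_inj,
    (degreeLTEquiv ℝ (f ^ n).natDegree).finrank_eq, Module.finrank_fin_fun]
  rw [← LinearMap.ker_eq_bot, LinearMap.ker_eq_bot']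
  rintro ⟨q, hq⟩ h0
  have hd : f ^ n ∣ q := (h.ker q).1 h0
  rw [mem_degreeLT, ← degree_eq_natDegree (h.monic.pow n).ne_zero] at hq
  exact Subtype.ext (eq_zero_of_dvd_of_degree_lt hd hq)

/-- Two cyclic operators with the same annihilating polynomial are similar. -/
theorem exists_equiv {W' : Type*} [AddCommGroup W'] [Module ℝ W'] {A' : Module.End ℝ W'} {v' : W'}
    (h : IsPrimaryVector A f n v) (h' : IsPrimaryVector A' f n v')
    (hr : LinearMap.range (evalAt A v) = ⊤) (hr' : LinearMap.range (evalAt A' v') = ⊤) :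
    ∃ φ : W ≃ₗ[ℝ] W', ∀ w, φ (A w) = A' (φ w) := by
  have hs := LinearMap.range_eq_top.1 hr
  have hs' := LinearMap.range_eq_top.1 hr'
  have hker : LinearMap.ker (evalAt A v) = LinearMap.ker (evalAt A' v') := by
    ext q
    rw [LinearMap.mem_ker, LinearMap.mem_ker, h.ker, h'.ker]
  let φ : W ≃ₗ[ℝ] W' := (LinearMap.quotKerEquivOfSurjective _ hs).symm ≪≫ₗ
    Submodule.quotEquivOfEq _ _ hker ≪≫ₗ LinearMap.quotKerEquivOfSurjective _ hs'
  have hφ : ∀ q, φ (evalAt A v q) = evalAt A' v' q := fun q => by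
    have : (LinearMap.quotKerEquivOfSurjective _ hs).symm (evalAt A v q) =
        Submodule.Quotient.mk q := by
      rw [LinearEquiv.symm_apply_eq]
      rfl
    simp only [φ, LinearEquiv.trans_apply, this, Submodule.quotEquivOfEq_mk]
    rfl
  refine ⟨φ, fun w => ?_⟩
  obtain ⟨q, rfl⟩ := hs w
  have e := hφ (X * q)
  rw [evalAt_mul, evalAt_mul, aeval_X, aeval_X] at e
  rw [e, hφ]

end IsPrimaryVector

/-! ### Jordan blocks are the cyclic operators annihilated by a power of an irreducible -/

theorem IsJordanBlock.of_equiv {W W' : Type*} [AddCommGroup W] [Module ℝ W] [AddCommGroup W']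
    [Module ℝ W'] {B : Module.End ℝ W} {B' : Module.End ℝ W'} (φ : W ≃ₗ[ℝ] W')
    (h : ∀ w, φ (B w) = B' (φ w)) (hB : IsJordanBlock B') : IsJordanBlock B := by
  have key : ∀ {ι : Type} [Fintype ι] [DecidableEq ι] (e : Module.Basis ι ℝ W'),
      LinearMap.toMatrix (e.map φ.symm) (e.map φ.symm) B = LinearMap.toMatrix e e B' := by
    intro ι _ _ e
    ext i j
    simp [LinearMap.toMatrix_apply, h]
  rcases hB with ⟨n, c, e, hn, he⟩ | ⟨n, a, b, e, hn, hb, he⟩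
  · exact Or.inl ⟨n, c, e.map φ.symm, hn, (key e).trans he⟩
  · exact Or.inr ⟨n, a, b, e.map φ.symm, hn, hb, (key e).trans he⟩

/-- The family `w` read backwards and continued by zero. -/
def revSeq {W : Type*} [AddCommGroup W] {n : ℕ} (w : Fin n → W) (i : ℕ) : W :=
  if h : i < n then w ⟨n - 1 - i, by omega⟩ else 0

theorem revSeq_of_le {W : Type*} [AddCommGroup W] {n : ℕ} (w : Fin n → W) {i : ℕ} (h : n ≤ i) :
    revSeq w i = 0 := dif_neg (by omega)

/-- This is column n-1-i of a matrix with x on the diagonal and y just above it. Such a column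
refers to the preceding basis vector, so reversing the order turns it into a forward shift; the
continuation by zero covers i = n-1, whose column has no entry above the diagonal. -/
theorem sum_superdiagonal {W : Type*} [AddCommGroup W] [Module ℝ W] {n : ℕ} (w : Fin n → W)
    (x y : ℝ) (i : ℕ) (hi : i < n) :
    ∑ k : Fin n, (if k = ⟨n - 1 - i, by omega⟩ then x
      else if k.val + 1 = n - 1 - i then y else 0) • w k =
      x • revSeq w i + y • revSeq w (i + 1) := by
  have hsplit : ∀ k : Fin n, (if k = ⟨n - 1 - i, by omega⟩ then x
      else if k.val + 1 = n - 1 - i then y else 0) • w k =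
      (if k = ⟨n - 1 - i, by omega⟩ then x • w k else 0) +
        (if k.val + 1 = n - 1 - i then y • w k else 0) := by
    intro k
    by_cases h1 : k = ⟨n - 1 - i, by omega⟩
    · have : ¬ k.val + 1 = n - 1 - i := by rw [h1]; simp
      rw [if_pos h1, if_pos h1, if_neg this, add_zero]
    · rw [if_neg h1, if_neg h1, ite_smul, zero_smul, zero_add]
  rw [Finset.sum_congr rfl fun k _ => hsplit k, Finset.sum_add_distrib,
    Finset.sum_ite_eq' Finset.univ, if_pos (Finset.mem_univ _)]
  congr 1
  · rw [revSeq, dif_pos hi]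
  · by_cases h : i + 1 < n
    · have hk : ∀ k : Fin n, k.val + 1 = n - 1 - i ↔ k = ⟨n - 1 - (i + 1), by omega⟩ := by
        intro k
        rw [Fin.ext_iff]
        simp only
        omega
      simp only [hk]
      rw [Finset.sum_ite_eq' Finset.univ, if_pos (Finset.mem_univ _), revSeq, dif_pos h]
    · rw [revSeq_of_le w (by omega), smul_zero]
      refine Finset.sum_eq_zero fun k _ => if_neg ?_
      omega

/-- If `f(B)` shifts the chain `u` by one step up to non-zero factors and terms further down the
chain, the top of the chain generates the whole space. -/
theorem exists_isPrimaryVector_of_chain {W ι : Type*} [AddCommGroup W] [Module ℝ W] [Nonempty ι]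
    (B : Module.End ℝ W) (f : ℝ[X]) (hf : Irreducible f) (hm : f.Monic) (n : ℕ) (hn : 0 < n)
    (u : ℕ → ι → W) (hu0 : ∀ i s, n ≤ i → u i s = 0) (hu1 : ∀ i s, i < n → u i s ≠ 0)
    (hstep : ∀ i s, ∃ c : ℝ, c ≠ 0 ∧ ∃ t, aeval B f (u i s) - c • u (i + 1) t ∈
      Submodule.span ℝ {w | ∃ j r, i + 2 ≤ j ∧ u j r = w})
    [FiniteDimensional ℝ W] (hdim : Module.finrank ℝ W = n * f.natDegree) :
    ∃ v, IsPrimaryVector B f n v ∧ LinearMap.range (evalAt B v) = ⊤ := by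
  -- The filtration by the tails of the chain: f(B) maps each term into the next, and only the
  -- leading coefficient modulo the following term needs to be tracked.
  let S : ℕ → Submodule ℝ W := fun k => Submodule.span ℝ {w | ∃ j r, k ≤ j ∧ u j r = w}
  have huS : ∀ {k j} r, k ≤ j → u j r ∈ S k := fun {k j} r h => Submodule.subset_span ⟨j, r, h, rfl⟩
  have hmono : ∀ {k l}, k ≤ l → S l ≤ S k := fun {k l} hkl => by
    refine Submodule.span_mono ?_
    rintro _ ⟨j, r, hj, rfl⟩
    exact ⟨j, r, hkl.trans hj, rfl⟩
  have hS0 : S n = ⊥ := by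
    rw [Submodule.span_eq_bot]
    rintro _ ⟨j, r, hj, rfl⟩
    exact hu0 j r hj
  have hF : ∀ k, ∀ w ∈ S k, aeval B f w ∈ S (k + 1) := fun k w hw => by
    have : S k ≤ (S (k + 1)).comap (aeval B f) := by
      refine Submodule.span_le.2 ?_
      rintro _ ⟨j, r, hj, rfl⟩
      obtain ⟨c, -, t, h⟩ := hstep j r
      have h2 := (S (k + 1)).add_mem (hmono (by omega : k + 1 ≤ j + 2) h)
        ((S (k + 1)).smul_mem c (huS t (by omega : k + 1 ≤ j + 1)))
      rwa [sub_add_cancel] at h2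
    exact this hw
  obtain ⟨s⟩ := ‹Nonempty ι›
  have hlead : ∀ k, ∃ c : ℝ, c ≠ 0 ∧ ∃ t, evalAt B (u 0 s) (f ^ k) - c • u k t ∈ S (k + 1) := by
    intro k
    induction k with
    | zero => exact ⟨1, one_ne_zero, s, by simp [evalAt_apply]⟩
    | succ k ih =>
      obtain ⟨c, hc, t, h⟩ := ih
      obtain ⟨d, hd, r, h'⟩ := hstep k t
      refine ⟨c * d, mul_ne_zero hc hd, r, ?_⟩
      have e : evalAt B (u 0 s) (f ^ (k + 1)) - (c * d) • u (k + 1) r =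
          aeval B f (evalAt B (u 0 s) (f ^ k) - c • u k t) +
            c • (aeval B f (u k t) - d • u (k + 1) r) := by
        rw [pow_succ', evalAt_mul, map_sub, map_smul, smul_sub, mul_smul]
        abel
      rw [e]
      exact (S _).add_mem (hF _ _ h) ((S _).smul_mem c h')
  have hprim : IsPrimaryVector B f n (u 0 s) := by
    refine .of_apply hf hm hn ?_ ?_
    · obtain ⟨c, -, t, h⟩ := hlead n
      have := hmono (Nat.le_succ n) h
      rwa [hS0, Submodule.mem_bot, hu0 n t le_rfl, smul_zero, sub_zero] at this
    · obtain ⟨c, hc, t, h⟩ := hlead (n - 1)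
      rw [Nat.sub_add_cancel hn, hS0, Submodule.mem_bot, sub_eq_zero] at h
      rw [h]
      exact smul_ne_zero hc (hu1 _ _ (by omega))
  refine ⟨u 0 s, hprim, Submodule.eq_top_of_finrank_eq ?_⟩
  rw [hprim.finrank_range, hdim, natDegree_pow]

theorem exists_isPrimaryVector_of_jordanMatrix {W : Type*} [AddCommGroup W] [Module ℝ W]
    (B : Module.End ℝ W) (n : ℕ) (hn : 0 < n) (c : ℝ) (e : Module.Basis (Fin n) ℝ W)
    (he : LinearMap.toMatrix e e B = jordanMatrix n c) :
    ∃ v, IsPrimaryVector B (X - C c) n v ∧ LinearMap.range (evalAt B v) = ⊤ := by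
  have : FiniteDimensional ℝ W := e.finiteDimensional_of_finite
  refine exists_isPrimaryVector_of_chain (ι := Unit) B _ (irreducible_X_sub_C c) (monic_X_sub_C c)
    n hn (fun i _ => revSeq e i) (fun i _ h => revSeq_of_le _ h) ?_ ?_ ?_
  · intro i _ h
    rw [revSeq, dif_pos h]
    exact e.ne_zero _
  · intro i _
    refine ⟨1, one_ne_zero, (), ?_⟩
    convert Submodule.zero_mem _
    rw [one_smul, sub_eq_zero]
    by_cases h : i < n
    · have h1 : B (revSeq e i) = c • revSeq e i + (1 : ℝ) • revSeq e (i + 1) := by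
        rw [← sum_superdiagonal e c 1 i h]
        conv_lhs => rw [← Matrix.toLin_toMatrix e e B, he, revSeq, dif_pos h, Matrix.toLin_self]
        rfl
      rw [map_sub, aeval_X, aeval_C, LinearMap.sub_apply, h1, Module.algebraMap_end_apply]
      simp
    · rw [revSeq_of_le _ (by omega), revSeq_of_le _ (by omega), map_zero]
  · rw [Module.finrank_eq_card_basis e, Fintype.card_fin, natDegree_X_sub_C, mul_one]

theorem monic_quadratic (a b : ℝ) : ((X - C a) ^ 2 + C (b ^ 2) : ℝ[X]).Monic := by
  monicity!

theorem natDegree_quadratic (a b : ℝ) : ((X - C a) ^ 2 + C (b ^ 2) : ℝ[X]).natDegree = 2 := by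
  compute_degree!

theorem irreducible_quadratic (a b : ℝ) (hb : b ≠ 0) :
    Irreducible ((X - C a) ^ 2 + C (b ^ 2) : ℝ[X]) := by
  refine irreducible_of_degree_le_three_of_not_isRoot ?_ fun x hx => ?_
  · rw [natDegree_quadratic]
    decide
  · simp only [IsRoot, eval_add, eval_pow, eval_sub, eval_X, eval_C] at hx
    have : 0 < b ^ 2 := by positivity
    nlinarith [sq_nonneg (x - a)]

/-- Write B = J + N with N the shift and J acting on each pair of chain vectors. Then JN = NJ and
f(J) = 0, so f(B) = 2(J - a)N + N². Since J - a interchanges the two vectors of a pair up to the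
factors ∓b, f(B) shifts by one step with factor ∓2b, leaving a remainder two steps down. -/
theorem exists_isPrimaryVector_of_realJordanMatrix {W : Type*} [AddCommGroup W] [Module ℝ W]
    (B : Module.End ℝ W) (n : ℕ) (hn : 0 < n) (a b : ℝ) (hb : b ≠ 0)
    (e : Module.Basis (Fin n × Fin 2) ℝ W)
    (he : LinearMap.toMatrix e e B = realJordanMatrix n a b) :
    ∃ v, IsPrimaryVector B ((X - C a) ^ 2 + C (b ^ 2)) n v ∧
      LinearMap.range (evalAt B v) = ⊤ := by
  have : FiniteDimensional ℝ W := e.finiteDimensional_of_finite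
  let u : ℕ → Fin 2 → W := fun i r => revSeq (fun j => e (j, r)) i
  have hcol : ∀ i r, B (u i r) = !![a, b; -b, a] 0 r • u i 0 + !![a, b; -b, a] 1 r • u i 1 +
      u (i + 1) r := by
    intro i r
    by_cases h : i < n
    · have h0 : u i r = e (⟨n - 1 - i, by omega⟩, r) := by simp only [u, revSeq, dif_pos h]
      rw [h0]
      conv_lhs => rw [← Matrix.toLin_toMatrix e e B, he, Matrix.toLin_self]
      rw [Fintype.sum_prod_type_right, Fin.sum_univ_two]
      have hs : ∀ t : Fin 2, ∑ k : Fin n,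
          realJordanMatrix n a b (k, t) (⟨n - 1 - i, by omega⟩, r) • e (k, t) =
          !![a, b; -b, a] t r • u i t + (if t = r then 1 else 0 : ℝ) • u (i + 1) t := by
        intro t
        rw [← sum_superdiagonal (fun k => e (k, t)) _ _ i h]
        refine Finset.sum_congr rfl fun k _ => ?_
        congr 1
        simp only [realJordanMatrix, Matrix.of_apply]
        split_ifs <;> simp_all
      rw [hs, hs]
      fin_cases r <;> simp <;> abel
    · have h0 : ∀ t j, i ≤ j → u j t = 0 := fun t j hj => revSeq_of_le _ (by omega)
      simp [h0 _ i le_rfl, h0 _ (i + 1) (Nat.le_succ i)]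
  have hc0 : ∀ i, B (u i 0) = a • u i 0 - b • u i 1 + u (i + 1) 0 := fun i => by
    rw [hcol]
    simp [sub_eq_add_neg]
  have hc1 : ∀ i, B (u i 1) = b • u i 0 + a • u i 1 + u (i + 1) 1 := fun i => by
    rw [hcol]
    simp
  have hquad : ∀ w, aeval B ((X - C a) ^ 2 + C (b ^ 2)) w =
      B (B w) - (2 * a) • B w + (a ^ 2 + b ^ 2) • w := fun w => by
    simp [pow_two, Module.algebraMap_end_apply]
    module
  refine exists_isPrimaryVector_of_chain B _ (irreducible_quadratic a b hb) (monic_quadratic a b)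
    n hn u (fun i r h => revSeq_of_le _ h) ?_ ?_ ?_
  · intro i r h
    simp only [u, revSeq, dif_pos h]
    exact e.ne_zero _
  · intro i r
    obtain rfl | rfl : r = 0 ∨ r = 1 := by fin_cases r <;> simp
    · refine ⟨-2 * b, by simpa using hb, 1, Submodule.subset_span ⟨i + 2, 0, le_rfl, ?_⟩⟩
      rw [hquad]
      simp only [hc0, hc1, map_add, map_sub, map_smul]
      module
    · refine ⟨2 * b, by simpa using hb, 0, Submodule.subset_span ⟨i + 2, 1, le_rfl, ?_⟩⟩
      rw [hquad]
      simp only [hc0, hc1, map_add, map_smul]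
      module
  · rw [Module.finrank_eq_card_basis e, Fintype.card_prod, Fintype.card_fin, Fintype.card_fin,
      natDegree_quadratic]

theorem IsJordanBlock.exists_isPrimaryVector {W : Type*} [AddCommGroup W] [Module ℝ W]
    {B : Module.End ℝ W} (hB : IsJordanBlock B) :
    ∃ f n v, IsPrimaryVector B f n v ∧ LinearMap.range (evalAt B v) = ⊤ := by
  rcases hB with ⟨n, c, e, hn, he⟩ | ⟨n, a, b, e, hn, hb, he⟩
  · exact ⟨_, n, exists_isPrimaryVector_of_jordanMatrix B n hn c e he⟩
  · exact ⟨_, n, exists_isPrimaryVector_of_realJordanMatrix B n hn a b hb e he⟩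

/-- Real irreducibles have degree at most two, and a quadratic one has no root, so completing the
square leaves a positive constant. -/
theorem Irreducible.eq_linear_or_quadratic {f : ℝ[X]} (hf : Irreducible f) (hm : f.Monic) :
    (∃ c, f = X - C c) ∨ ∃ a b, b ≠ 0 ∧ f = (X - C a) ^ 2 + C (b ^ 2) := by
  have h2 := hf.natDegree_le_two
  have h0 := hf.natDegree_pos
  have h12 : f.natDegree = 1 ∨ f.natDegree = 2 := by omega
  rcases h12 with h | h
  · refine Or.inl ⟨-f.coeff 0, ?_⟩
    rw [map_neg, sub_neg_eq_add]
    exact hm.eq_X_add_C h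
  · right
    have hf' : f = C 1 * X ^ 2 + C (f.coeff 1) * X + C (f.coeff 0) := by
      have h1 : f.coeff 2 = 1 := by
        rw [← h]
        exact hm
      rw [← h1]
      exact eq_quadratic_of_degree_le_two (degree_le_of_natDegree_le h2)
    set p := f.coeff 1
    set q := f.coeff 0
    have hpos : 0 < q - p ^ 2 / 4 := by
      by_contra hneg
      have hroot : f.IsRoot (-p / 2 + Real.sqrt (p ^ 2 / 4 - q)) := by
        have hs := Real.sq_sqrt (show 0 ≤ p ^ 2 / 4 - q by linarith)
        rw [IsRoot, hf']
        simp only [eval_add, eval_mul, eval_pow, eval_X, eval_C]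
        linear_combination hs
      have := natDegree_eq_of_degree_eq_some (degree_eq_one_of_irreducible_of_root hf hroot)
      rw [h] at this
      norm_num at this
    refine ⟨-p / 2, Real.sqrt (q - p ^ 2 / 4), (Real.sqrt_pos.2 hpos).ne', ?_⟩
    rw [Real.sq_sqrt hpos.le]
    conv_lhs => rw [hf']
    have e1 : (C (-p / 2) : ℝ[X]) = C (-1 / 2) * C p := by
      rw [← C_mul]
      ring_nf
    have e2 : (C (q - p ^ 2 / 4) : ℝ[X]) = C q - C (1 / 4) * C p ^ 2 := by
      rw [← C_pow, ← C_mul, ← C_sub]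
      ring_nf
    have e3 : (C (-1 / 2) : ℝ[X]) ^ 2 = C (1 / 4) := by
      rw [← C_pow]
      norm_num
    have e4 : (2 : ℝ[X]) * C (-1 / 2) = -1 := by
      rw [show (2 : ℝ[X]) = C 2 from rfl, ← C_mul, show (2 : ℝ) * (-1 / 2) = -1 by norm_num]
      simp
    rw [e1, e2, C_1]
    linear_combination (-(C p) ^ 2) * e3 + (X * C p) * e4

/-- No Jordan basis is constructed: the model Jordan matrix is cyclic with the same annihilator, and
cyclic operators with equal annihilators are similar. -/
theorem IsPrimaryVector.isJordanBlock {W : Type*} [AddCommGroup W] [Module ℝ W]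
    {B : Module.End ℝ W} {f : ℝ[X]} {n : ℕ} {v : W} (h : IsPrimaryVector B f n v)
    (hr : LinearMap.range (evalAt B v) = ⊤) : IsJordanBlock B := by
  rcases Irreducible.eq_linear_or_quadratic h.irreducible h.monic with ⟨c, rfl⟩ | ⟨a, b, hb, rfl⟩
  · have hM := LinearMap.toMatrix_toLin (Pi.basisFun ℝ (Fin n)) (Pi.basisFun ℝ (Fin n))
      (jordanMatrix n c)
    obtain ⟨v', h', hr'⟩ := exists_isPrimaryVector_of_jordanMatrix _ n h.pos c _ hM
    obtain ⟨φ, hφ⟩ := h.exists_equiv h' hr hr'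
    exact .of_equiv φ hφ (Or.inl ⟨n, c, _, h.pos, hM⟩)
  · have hM := LinearMap.toMatrix_toLin (Pi.basisFun ℝ (Fin n × Fin 2))
      (Pi.basisFun ℝ (Fin n × Fin 2)) (realJordanMatrix n a b)
    obtain ⟨v', h', hr'⟩ := exists_isPrimaryVector_of_realJordanMatrix _ n h.pos a b hb _ hM
    obtain ⟨φ, hφ⟩ := h.exists_equiv h' hr hr'
    exact .of_equiv φ hφ (Or.inr ⟨n, a, b, _, h.pos, hb, hM⟩)

/-! ### Existence of orthogonal Jordan decompositions -/

theorem aeval_restrict_apply {V : Type*} [AddCommGroup V] [Module ℝ V] {A : Module.End ℝ V}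
    {U : Submodule ℝ V} (hU : ∀ x ∈ U, A x ∈ U) (q : ℝ[X]) (x : U) :
    (aeval (A.restrict hU) q x : V) = aeval A q (x : V) := by
  induction q using Polynomial.induction_on' with
  | add p q hp hq => simp [hp, hq]
  | monomial m a =>
    simp [← C_mul_X_pow_eq_monomial, Module.algebraMap_end_apply, Module.End.pow_restrict m hU]

theorem form_aeval {V : Type*} [AddCommGroup V] [Module ℝ V] {g : LinearMap.BilinForm ℝ V}
    {A : Module.End ℝ V} (hA : g.IsSelfAdjoint A) (q : ℝ[X]) (x y : V) :
    g (aeval A q x) y = g x (aeval A q y) := by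
  have hpow : ∀ (m : ℕ) (x y : V), g ((A ^ m) x) y = g x ((A ^ m) y) := by
    intro m
    induction m with
    | zero => simp
    | succ m ih =>
      intro x y
      rw [pow_succ, Module.End.mul_apply, ih, hA, ← Module.End.mul_apply, ← pow_succ', pow_succ]
  induction q using Polynomial.induction_on' with
  | add p q hp hq => simp [hp, hq]
  | monomial m a =>
    simp [← C_mul_X_pow_eq_monomial, Module.algebraMap_end_apply, hpow]

theorem apply_mem_range_evalAt {V : Type*} [AddCommGroup V] [Module ℝ V] (A : Module.End ℝ V)
    (v : V) : ∀ x ∈ LinearMap.range (evalAt A v), A x ∈ LinearMap.range (evalAt A v) := by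
  rintro _ ⟨q, rfl⟩
  exact ⟨X * q, by rw [evalAt_mul, aeval_X]⟩

theorem self_mem_range_evalAt {V : Type*} [AddCommGroup V] [Module ℝ V] (A : Module.End ℝ V)
    (v : V) : v ∈ LinearMap.range (evalAt A v) :=
  ⟨1, by simp [evalAt_apply]⟩

theorem range_evalAt_le {V : Type*} [AddCommGroup V] [Module ℝ V] {A : Module.End ℝ V}
    {U : Submodule ℝ V} (hU : ∀ x ∈ U, A x ∈ U) {v : V} (hv : v ∈ U) :
    LinearMap.range (evalAt A v) ≤ U := by
  rintro _ ⟨q, rfl⟩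
  rw [evalAt_apply, ← aeval_restrict_apply hU q ⟨v, hv⟩]
  exact Subtype.property _

/-- A non-zero symmetric form over ℝ is non-zero on some diagonal pair (x, x). This is applied to
g(r(A)x, y), where r is chosen so that a square q(A)² can be shared between the two arguments. The
inequality obtained is what makes the cyclic subspace of v non-degenerate. -/
theorem exists_form_evalAt_ne_zero {V : Type*} [AddCommGroup V] [Module ℝ V]
    [FiniteDimensional ℝ V] [Nontrivial V] {g : LinearMap.BilinForm ℝ V} (hg : g.IsSymm)
    (hnd : ∀ x, (∀ y, g x y = 0) → x = 0) {A : Module.End ℝ V} (hA : g.IsSelfAdjoint A) :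
    ∃ f n v, IsPrimaryVector A f n v ∧ g (evalAt A v (f ^ (n - 1))) v ≠ 0 := by
  have hp0 : minpoly ℝ A ≠ 0 := minpoly.ne_zero (Algebra.IsIntegral.isIntegral A)
  obtain ⟨f, hfm, hf, hfp⟩ := exists_monic_irreducible_factor (minpoly ℝ A)
    (minpoly.not_isUnit ℝ A)
  obtain ⟨n, q, hq, hpq⟩ : ∃ n q, ¬ f ∣ q ∧ minpoly ℝ A = f ^ n * q := by
    obtain ⟨q, h1, h2⟩ :=
      (FiniteMultiplicity.of_prime_left hf.prime hp0).exists_eq_pow_mul_and_not_dvd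
    exact ⟨_, q, h2, h1⟩
  have hn : 0 < n := by
    rcases Nat.eq_zero_or_pos n with rfl | h
    · rw [pow_zero, one_mul] at hpq
      exact absurd (hpq ▸ hfp) hq
    · exact h
  have hq0 : q ≠ 0 := by
    rintro rfl
    exact hq (dvd_zero f)
  -- The minimal polynomial f^n q divides f^(n-1) q² only if f divides q.
  have hr : aeval A (f ^ (n - 1) * q ^ 2) ≠ 0 := by
    intro h
    have hd := minpoly.dvd ℝ A h
    rw [hpq, ← Nat.sub_add_cancel hn, pow_succ, Nat.add_sub_cancel, mul_assoc, pow_two,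
      mul_dvd_mul_iff_left (pow_ne_zero _ hf.ne_zero), mul_dvd_mul_iff_right hq0] at hd
    exact hq hd
  let h : LinearMap.BilinForm ℝ V := g ∘ₗ aeval A (f ^ (n - 1) * q ^ 2)
  have hh : ∀ x y, h x y = g (aeval A (f ^ (n - 1) * q ^ 2) x) y := fun _ _ => rfl
  have hsymm : LinearMap.IsSymm h :=
    ⟨fun x y => by rw [RingHom.id_apply, hh, hh, form_aeval hA, hg.eq]⟩
  have hne : h ≠ 0 := by
    intro h0
    refine hr (LinearMap.ext fun x => hnd _ fun y => ?_)
    rw [← hh, h0]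
    rfl
  obtain ⟨x, hx⟩ := LinearMap.BilinForm.exists_bilinForm_self_ne_zero hne hsymm
  -- The vector sought is q(A)x: self-adjointness moves one factor q(A) to the other side, and
  -- f^n(A)q(A)x = 0.
  have hne' : g (evalAt A (aeval A q x) (f ^ (n - 1))) (aeval A q x) ≠ 0 := by
    intro h0
    refine hx ?_
    change g (aeval A (f ^ (n - 1) * q ^ 2) x) x = 0
    rw [← h0, evalAt_apply, ← form_aeval hA, ← Module.End.mul_apply, ← Module.End.mul_apply,
      ← map_mul, ← map_mul]
    congr 4
    ring
  refine ⟨f, n, aeval A q x, .of_apply hf hfm hn ?_ fun h0 => hne' ?_, hne'⟩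
  · rw [evalAt_apply, ← Module.End.mul_apply, ← map_mul, ← hpq, minpoly.aeval,
      LinearMap.zero_apply]
  · rw [h0, map_zero, LinearMap.zero_apply]

namespace IsPrimaryVector

variable {V : Type*} [AddCommGroup V] [Module ℝ V] {g : LinearMap.BilinForm ℝ V}
  {A : Module.End ℝ V} {f : ℝ[X]} {n : ℕ} {v : V}

/-- A non-zero vector of the intersection has f^(n-1)(A)v as a multiple a(A)q(A)v. Moving a(A)
across g pairs q(A)v with a vector of the cyclic subspace, which gives zero and contradicts the
assumption on v. -/
theorem disjoint_orthogonal (h : IsPrimaryVector A f n v) (hg : g.IsSymm)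
    (hA : g.IsSelfAdjoint A) (hv : g (evalAt A v (f ^ (n - 1))) v ≠ 0) :
    Disjoint (LinearMap.range (evalAt A v)) (g.orthogonal (LinearMap.range (evalAt A v))) := by
  rw [Submodule.disjoint_def]
  rintro _ ⟨q, rfl⟩ hx
  by_contra hne
  obtain ⟨a, ha⟩ := exists_pow_dvd_mul_sub h.irreducible (mt (h.ker q).2 hne)
  have ha' := (h.ker _).2 ha
  rw [map_sub, sub_eq_zero, evalAt_mul] at ha'
  rw [← ha', form_aeval hA, hg.eq] at hv
  exact hv (LinearMap.BilinForm.mem_orthogonal_iff.1 hx _ ⟨a, rfl⟩)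

theorem restrict (h : IsPrimaryVector A f n v) {U : Submodule ℝ V} (hU : ∀ x ∈ U, A x ∈ U)
    (hv : v ∈ U) : IsPrimaryVector (A.restrict hU) f n (⟨v, hv⟩ : U) := by
  refine ⟨h.irreducible, h.monic, h.pos, fun q => ?_⟩
  rw [← h.ker, ← Submodule.coe_eq_zero, evalAt_apply, aeval_restrict_apply]
  rfl

theorem of_restrict {U : Submodule ℝ V} {hU : ∀ x ∈ U, A x ∈ U} {u : U}
    (h : IsPrimaryVector (A.restrict hU) f n u) : IsPrimaryVector A f n (u : V) := by
  refine ⟨h.irreducible, h.monic, h.pos, fun q => ?_⟩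
  rw [← h.ker, ← Submodule.coe_eq_zero, evalAt_apply, evalAt_apply, aeval_restrict_apply]

theorem isJordanBlock_restrict (h : IsPrimaryVector A f n v) {U : Submodule ℝ V}
    (hU : ∀ x ∈ U, A x ∈ U) (hUv : U = LinearMap.range (evalAt A v)) :
    IsJordanBlock (A.restrict hU) := by
  refine (h.restrict hU (hUv ▸ self_mem_range_evalAt A v)).isJordanBlock ?_
  rw [LinearMap.range_eq_top]
  rintro ⟨x, hx⟩
  obtain ⟨q, rfl⟩ := hUv ▸ hx
  exact ⟨q, Subtype.ext (aeval_restrict_apply hU q _)⟩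

end IsPrimaryVector

/-- Induction on dimension: the orthogonal complement in U of a non-degenerate cyclic subspace is
again invariant and non-degenerate. Non-degeneracy of each piece is recorded because, with
orthogonality, it yields linear independence of the family. -/
theorem exists_cyclic_decomposition {V : Type*} [AddCommGroup V] [Module ℝ V]
    [FiniteDimensional ℝ V] {g : LinearMap.BilinForm ℝ V} (hg : g.IsSymm) {A : Module.End ℝ V}
    (hA : g.IsSelfAdjoint A) (U : Submodule ℝ V) (hU : ∀ x ∈ U, A x ∈ U)
    (hnd : Disjoint U (g.orthogonal U)) :
    ∃ (s : ℕ) (W : Fin s → Submodule ℝ V),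
      (∀ α β, α ≠ β → ∀ x ∈ W α, ∀ y ∈ W β, g x y = 0) ∧
      (∀ α, Disjoint (W α) (g.orthogonal (W α))) ∧
      (∀ α, ∃ f n v, IsPrimaryVector A f n v ∧ W α = LinearMap.range (evalAt A v)) ∧
      iSup W = U := by
  induction hd : Module.finrank ℝ U using Nat.strong_induction_on generalizing U with
  | _ d ih =>
  rcases eq_or_ne U ⊥ with rfl | hne
  · exact ⟨0, Fin.elim0, fun α => α.elim0, fun α => α.elim0, fun α => α.elim0, by simp⟩
  have : Nontrivial U := Submodule.nontrivial_iff_ne_bot.2 hne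
  obtain ⟨f, n, ⟨v, hv⟩, h, hne'⟩ := exists_form_evalAt_ne_zero (g := g.restrict U)
    (A := A.restrict hU) ⟨fun x y => hg.eq x y⟩ (fun x hx => by
      refine Subtype.ext (Submodule.disjoint_def.1 hnd x x.2 ?_)
      rw [LinearMap.BilinForm.mem_orthogonal_iff]
      intro y hy
      rw [hg.eq]
      exact hx ⟨y, hy⟩) (fun x y => hA x y)
  replace h := h.of_restrict
  replace hne' : g (evalAt A v (f ^ (n - 1))) v ≠ 0 := by
    rw [evalAt_apply, ← aeval_restrict_apply hU _ ⟨v, hv⟩]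
    exact hne'
  set C := LinearMap.range (evalAt A v) with hC
  have hCU : C ≤ U := range_evalAt_le hU hv
  have hCd : Disjoint C (g.orthogonal C) := h.disjoint_orthogonal hg hA hne'
  have hrefl : g.IsRefl := fun x y hxy => by rw [hg.eq, hxy]
  have hCc : IsCompl C (g.orthogonal C) :=
    (LinearMap.BilinForm.isCompl_orthogonal_iff_disjoint hrefl).2 hCd
  have hsup : C ⊔ U ⊓ g.orthogonal C = U := by
    rw [inf_comm, ← sup_inf_assoc_of_le _ hCU, hCc.sup_eq_top, top_inf_eq]
  have hinv : ∀ x ∈ U ⊓ g.orthogonal C, A x ∈ U ⊓ g.orthogonal C := by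
    rintro x ⟨hxU, hxC⟩
    refine ⟨hU x hxU, ?_⟩
    rw [SetLike.mem_coe, LinearMap.BilinForm.mem_orthogonal_iff] at hxC ⊢
    intro y hy
    rw [← hA]
    exact hxC _ (apply_mem_range_evalAt A v y hy)
  have hdisj : Disjoint (U ⊓ g.orthogonal C) (g.orthogonal (U ⊓ g.orthogonal C)) := by
    rw [Submodule.disjoint_def]
    rintro x ⟨hxU, hxC⟩ hx
    refine Submodule.disjoint_def.1 hnd x hxU ?_
    rw [SetLike.mem_coe, LinearMap.BilinForm.mem_orthogonal_iff] at hxC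
    rw [LinearMap.BilinForm.mem_orthogonal_iff] at hx ⊢
    intro y hy
    rw [← hsup] at hy
    obtain ⟨c, hc, u, hu, rfl⟩ := Submodule.mem_sup.1 hy
    rw [map_add, LinearMap.add_apply, hxC c hc, hx u hu, add_zero]
  have hlt : U ⊓ g.orthogonal C < U := by
    -- Equality would place v in the orthogonal complement of its own cyclic subspace, which
    -- contains f^(n-1)(A)v.
    refine lt_of_le_of_ne inf_le_left fun he => hne' ?_
    rw [← he] at hv
    exact LinearMap.BilinForm.mem_orthogonal_iff.1 hv.2 _ ⟨_, rfl⟩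
  obtain ⟨s, W, ho, hWd, hW, hWsup⟩ := ih _ (hd ▸ Submodule.finrank_lt_finrank_of_lt hlt)
    (U ⊓ g.orthogonal C) hinv hdisj rfl
  have hWC : ∀ α, ∀ x ∈ C, ∀ y ∈ W α, g x y = 0 := fun α x hx y hy =>
    LinearMap.BilinForm.mem_orthogonal_iff.1 ((hWsup.le.trans' (le_iSup W α)) hy).2 x hx
  refine ⟨s + 1, Fin.cons C W, ?_, ?_, ?_, ?_⟩
  · intro α β hαβ
    refine Fin.cases ?_ (fun α => ?_) α
      (motive := fun α => α ≠ β → ∀ x ∈ (Fin.cons C W : Fin (s + 1) → Submodule ℝ V) α,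
        ∀ y ∈ (Fin.cons C W : Fin (s + 1) → Submodule ℝ V) β, g x y = 0) hαβ
    · refine Fin.cases (fun h => absurd rfl h) (fun β _ => ?_) β
      simpa using hWC β
    · refine Fin.cases (fun _ => ?_) (fun β hβ => ?_) β
      · intro x hx y hy
        rw [hg.eq]
        exact hWC α y hy x hx
      · exact ho α β fun h => hβ (congrArg _ h)
  · exact Fin.cases hCd hWd
  · exact Fin.cases ⟨f, n, v, h, rfl⟩ hW
  · rw [← hsup, ← hWsup]
    refine le_antisymm (iSup_le (Fin.cases le_sup_left fun α => (le_iSup W α).trans le_sup_right))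
      (sup_le ?_ (iSup_le fun α => ?_))
    · exact le_iSup (Fin.cons C W : Fin (s + 1) → Submodule ℝ V) 0
    · exact le_iSup (Fin.cons C W : Fin (s + 1) → Submodule ℝ V) α.succ

theorem nonempty_jordanDecomposition {V : Type*} [AddCommGroup V] [Module ℝ V]
    [FiniteDimensional ℝ V] {g : LinearMap.BilinForm ℝ V} (hg : g.IsSymm) (hnd : g.Nondegenerate)
    {A : Module.End ℝ V} (hA : g.IsSelfAdjoint A) : Nonempty (JordanDecomposition g A) := by
  obtain ⟨s, W, ho, hWd, hW, hWsup⟩ := exists_cyclic_decomposition hg hA ⊤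
    (fun _ _ => Submodule.mem_top) (by
      rw [Submodule.disjoint_def]
      intro x _ hx
      exact hnd.2 x fun y => LinearMap.BilinForm.mem_orthogonal_iff.1 hx y Submodule.mem_top)
  have hinv : ∀ α, ∀ x ∈ W α, A x ∈ W α := fun α => by
    obtain ⟨f, n, v, -, h⟩ := hW α
    rw [h]
    exact apply_mem_range_evalAt A v
  refine ⟨⟨s, W, ?_, ho, hinv, fun α => ?_⟩⟩
  · rw [DirectSum.isInternal_submodule_iff_iSupIndep_and_iSup_eq_top]
    refine ⟨fun α => (hWd α).mono_right (iSup₂_le fun β hβ y hy => ?_), hWsup⟩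
    rw [LinearMap.BilinForm.mem_orthogonal_iff]
    exact fun x hx => ho α β hβ.symm x hx y hy
  · obtain ⟨f, n, v, h, hv⟩ := hW α
    exact h.isJordanBlock_restrict (hinv α) hv

/-! ### The derivative of a polynomial at an operator -/

section PolyDeriv

variable {V : Type*} [AddCommGroup V] [Module ℝ V] {g : LinearMap.BilinForm ℝ V}
  {A : Module.End ℝ V}

/-- For a monomial t^m the commutator telescopes along the terms A^(m-j) X A^j. -/
theorem polyDeriv_mul_sub_mul (p : ℝ[X]) (A X : Module.End ℝ V) :
    polyDeriv p A X * A - A * polyDeriv p A X = X * aeval A p - aeval A p * X := by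
  have h : ∀ m, (∑ j ∈ Finset.range m, A ^ (m - 1 - j) * X * A ^ j) * A -
      A * (∑ j ∈ Finset.range m, A ^ (m - 1 - j) * X * A ^ j) = X * A ^ m - A ^ m * X := by
    intro m
    have ht := Finset.sum_range_sub (fun j => A ^ (m - j) * X * A ^ j) m
    simp only [Nat.sub_self, pow_zero, one_mul, Nat.sub_zero, mul_one] at ht
    rw [← ht, Finset.sum_mul, Finset.mul_sum, ← Finset.sum_sub_distrib]
    refine Finset.sum_congr rfl fun j hj => ?_
    have hj' := Finset.mem_range.1 hj
    rw [show m - (j + 1) = m - 1 - j by omega, show m - j = m - 1 - j + 1 by omega, pow_succ A j,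
      pow_succ' A (m - 1 - j)]
    simp only [mul_assoc]
  rw [polyDeriv_apply, aeval_eq_sum_range, ← Polynomial.sum_over_range p
    (f := fun m a => a • A ^ m) (by simp), Polynomial.sum_def]
  simp only [Finset.sum_mul, Finset.mul_sum, smul_mul_assoc, mul_smul_comm,
    ← Finset.sum_sub_distrib, ← smul_sub]
  refine Finset.sum_congr rfl fun m _ => ?_
  rw [← h m]
  simp only [Finset.sum_mul, Finset.mul_sum, Finset.sum_sub_distrib]

theorem polyDeriv_wedgeOp_apply (p : ℝ[X]) (A : Module.End ℝ V) (w z x : V) :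
    polyDeriv p A (wedgeOp g w z) x = ∑ m ∈ p.support, p.coeff m • ∑ j ∈ Finset.range m,
      (g z ((A ^ j) x) • (A ^ (m - 1 - j)) w - g w ((A ^ j) x) • (A ^ (m - 1 - j)) z) := by
  simp [polyDeriv_apply, LinearMap.sum_apply, wedgeOp_apply]

/-- The six terms cancel in pairs by the symmetry of g(x, Cy). -/
theorem wedgeOp_bianchi (hg : g.IsSymm) (B : Module.End ℝ V) {C : Module.End ℝ V}
    (hC : ∀ x y, g (C x) y = g x (C y)) (u v w : V) :
    B (wedgeOp g u v (C w)) + B (wedgeOp g v w (C u)) + B (wedgeOp g w u (C v)) = 0 := by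
  have h : ∀ x y, g x (C y) = g y (C x) := fun x y => by rw [← hC, hg.eq]
  simp only [wedgeOp_apply, map_sub, map_smul]
  rw [h v w, h u w, h v u]
  abel

theorem commute_aeval {T A : Module.End ℝ V} (h : ∀ x, T (A x) = A (T x)) (q : ℝ[X]) (x : V) :
    T (aeval A q x) = aeval A q (T x) := by
  induction q using Polynomial.induction_on' with
  | add p q hp hq => simp [hp, hq]
  | monomial m a =>
    have : ∀ x, T ((A ^ m) x) = (A ^ m) (T x) := by
      induction m with
      | zero => simp
      | succ m ih => intro x; rw [pow_succ, Module.End.mul_apply, ih, h, ← Module.End.mul_apply]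
    simp [← C_mul_X_pow_eq_monomial, Module.algebraMap_end_apply, this]

theorem polyDeriv_bianchi (hg : g.IsSymm) (hA : g.IsSelfAdjoint A) (p : ℝ[X])
    {P : Module.End ℝ V} (hP : ∀ x y, g (P x) y = g x (P y)) (hPA : ∀ x, P (A x) = A (P x))
    (u v w : V) :
    polyDeriv p A (P * wedgeOp g u v * P) w + polyDeriv p A (P * wedgeOp g v w * P) u +
      polyDeriv p A (P * wedgeOp g w u * P) v = 0 := by
  simp only [polyDeriv_apply, LinearMap.sum_apply, LinearMap.smul_apply,
    ← Finset.sum_add_distrib, ← smul_add]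
  refine Finset.sum_eq_zero fun m _ => ?_
  rw [Finset.sum_eq_zero fun j _ => ?_, smul_zero]
  -- Each summand reads (A^(m-1-j) P)(u ∧ v)(P A^j), whose right factor is self-adjoint because P
  -- and A commute.
  have hC : ∀ x y, g ((P * A ^ j) x) y = g x ((P * A ^ j) y) := fun x y => by
    have h1 := form_aeval hA (X ^ j) x (P y)
    have h2 := commute_aeval hPA (X ^ j) y
    rw [map_pow, aeval_X] at h1 h2
    rw [Module.End.mul_apply, Module.End.mul_apply, hP, h1, h2]
  exact wedgeOp_bianchi hg (A ^ (m - 1 - j) * P) hC u v w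

theorem mem_centraliser {Y : Module.End ℝ V} :
    Y ∈ centraliser g A ↔ Y ∈ so g ∧ ∀ x, Y (A x) = A (Y x) := by
  refine and_congr Iff.rfl ?_
  rw [LieRing.of_associative_ring_bracket, sub_eq_zero, LinearMap.ext_iff]
  rfl

/-- The dual of the cyclic vector `v` with respect to the powers of `A`. -/
theorem IsPrimaryVector.exists_dual_vector [FiniteDimensional ℝ V] {f : ℝ[X]} {n : ℕ} {v : V}
    (h : IsPrimaryVector A f n v) (hnd : g.Nondegenerate) :
    ∃ z, g z ((A ^ ((f ^ n).natDegree - 1)) v) = 1 ∧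
      ∀ j < (f ^ n).natDegree - 1, g z ((A ^ j) v) = 0 := by
  set N := (f ^ n).natDegree with hN
  have hN0 : 0 < N := by
    rw [hN, natDegree_pow]
    exact Nat.mul_pos h.pos h.irreducible.natDegree_pos
  have hpow : ∀ j, (A ^ j) v = evalAt A v (X ^ j) := fun j => by simp [evalAt_apply]
  -- Otherwise f^n, of degree N, would divide the polynomial X^(N-1) - q of degree N-1. A functional
  -- separating A^(N-1) v from the lower powers is then represented by a vector through g.
  have hnot : (A ^ (N - 1)) v ∉ (degreeLT ℝ (N - 1)).map (evalAt A v) := by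
    rintro ⟨q, hq, he⟩
    rw [SetLike.mem_coe, mem_degreeLT] at hq
    rw [hpow, eq_comm, ← sub_eq_zero, ← map_sub, h.ker] at he
    have hq' : q.degree < (X ^ (N - 1) : ℝ[X]).degree := by rwa [degree_X_pow]
    have hdeg : (X ^ (N - 1) - q).degree = ((N - 1 : ℕ) : WithBot ℕ) := by
      rw [degree_sub_eq_left_of_degree_lt hq', degree_X_pow]
    have h0 := eq_zero_of_dvd_of_degree_lt he (by
      rw [hdeg, degree_eq_natDegree (h.monic.pow n).ne_zero, Nat.cast_lt]
      omega)
    rw [h0, degree_zero] at hdeg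
    exact absurd hdeg (by simp)
  obtain ⟨φ, hφ, hker⟩ := Submodule.exists_le_ker_of_notMem hnot
  let z := (g.toDual hnd).symm ((φ ((A ^ (N - 1)) v))⁻¹ • φ)
  have hz : ∀ x, g z x = (φ ((A ^ (N - 1)) v))⁻¹ * φ x := fun x => by
    rw [← LinearMap.BilinForm.toDual_def hnd, LinearEquiv.apply_symm_apply]
    rfl
  refine ⟨z, by rw [hz, inv_mul_cancel₀ hφ], fun j hj => ?_⟩
  have : φ ((A ^ j) v) = 0 := hker ⟨X ^ j, by
    rw [SetLike.mem_coe, mem_degreeLT, degree_X_pow]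
    exact_mod_cast hj, (hpow j).symm⟩
  rw [hz, this, mul_zero]

/-- Among all terms g(z, A^j v) A^(m-1-j) w only j = N-1 survives, N being the degree of p. It
occurs only for m = N, where the coefficient is 1 and the power of A is trivial. -/
theorem polyDeriv_wedgeOp_apply_of_dual {p : ℝ[X]} (hp : p.Monic) {w z v : V}
    (hw : ∀ j, g w ((A ^ j) v) = 0) (h1 : g z ((A ^ (p.natDegree - 1)) v) = 1)
    (h0 : ∀ j < p.natDegree - 1, g z ((A ^ j) v) = 0) (hp0 : 0 < p.natDegree) :
    polyDeriv p A (wedgeOp g w z) v = w := by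
  rw [polyDeriv_wedgeOp_apply, Finset.sum_eq_single p.natDegree]
  · rw [hp.coeff_natDegree, one_smul, Finset.sum_eq_single (p.natDegree - 1)]
    · simp [hw, h1]
    · intro j hj hne
      have := Finset.mem_range.1 hj
      rw [hw, h0 j (by omega), zero_smul, zero_smul, sub_zero]
    · intro h
      exact absurd (Finset.mem_range.2 (by omega)) h
  · intro m hm hne
    have hle := le_natDegree_of_mem_supp m hm
    rw [Finset.sum_eq_zero fun j hj => ?_, smul_zero]
    have := Finset.mem_range.1 hj
    rw [hw, h0 j (by omega), zero_smul, zero_smul, sub_zero]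
  · intro h
    rw [notMem_support_iff.1 h, zero_smul]

end PolyDeriv

namespace JordanDecomposition

variable {V : Type*} [AddCommGroup V] [Module ℝ V] {g : LinearMap.BilinForm ℝ V}
  {A : Module.End ℝ V} (D : JordanDecomposition g A)

/-! ### The orthogonal projections -/

/-- The `g`-orthogonal projection onto `V_α + V_β`, as an operator on `V`. -/
noncomputable def projEnd (α β : Fin D.s) : Module.End ℝ V :=
  (D.pair α β).subtype ∘ₗ D.proj α β

theorem projEnd_mem (α β : Fin D.s) (x : V) : D.projEnd α β x ∈ D.pair α β :=
  (D.proj α β x).2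

theorem projEnd_self_mem (α : Fin D.s) (x : V) : D.projEnd α α x ∈ D.W α := by
  have := D.projEnd_mem α α x
  rwa [pair, sup_idem] at this

theorem le_pair_left (α β : Fin D.s) : D.W α ≤ D.pair α β := le_sup_left

theorem le_pair_right (α β : Fin D.s) : D.W β ≤ D.pair α β := le_sup_right

theorem projEnd_of_mem (α β : Fin D.s) {x : V} (hx : x ∈ D.pair α β) : D.projEnd α β x = x :=
  congrArg Subtype.val (Submodule.projectionOnto_apply_left (D.isCompl_pair_rest α β) ⟨x, hx⟩)

theorem projEnd_of_ne {α β γ : Fin D.s} (hα : γ ≠ α) (hβ : γ ≠ β) {x : V} (hx : x ∈ D.W γ) :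
    D.projEnd α β x = 0 := by
  have : x ∈ D.rest α β := (le_biSup D.W (show γ ∈ {γ : Fin D.s | γ ≠ α ∧ γ ≠ β} from ⟨hα, hβ⟩)) hx
  have h := (Submodule.projectionOnto_apply_eq_zero_iff (D.isCompl_pair_rest α β)).2 this
  exact congrArg Subtype.val h

theorem form_projEnd (α β : Fin D.s) (x y : V) :
    g (D.projEnd α β x) y = g x (D.projEnd α β y) :=
  (D.form_proj_right α β (D.proj α β x) y).symm.trans (D.form_proj_left α β x (D.proj α β y))

variable {D} in
theorem ext_blocks {M : Type*} [AddCommGroup M] [Module ℝ M] {S T : V →ₗ[ℝ] M}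
    (h : ∀ α, ∀ x ∈ D.W α, S x = T x) : S = T := by
  have : (⊤ : Submodule ℝ V) ≤ LinearMap.eqLocus S T := by
    rw [← D.isInternal.submodule_iSup_eq_top]
    exact iSup_le h
  exact LinearMap.ext fun x => this Submodule.mem_top

theorem projEnd_comm (α β : Fin D.s) (x : V) : D.projEnd α β (A x) = A (D.projEnd α β x) := by
  have : D.projEnd α β * A = A * D.projEnd α β := by
    refine D.ext_blocks fun γ x hx => ?_
    simp only [Module.End.mul_apply]
    by_cases h : γ = α ∨ γ = β
    · have hx' : x ∈ D.pair α β := by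
        rcases h with rfl | rfl
        · exact D.le_pair_left _ _ hx
        · exact D.le_pair_right _ _ hx
      rw [D.projEnd_of_mem α β hx', D.projEnd_of_mem α β (D.pair_invariant α β x hx')]
    · rw [not_or] at h
      rw [D.projEnd_of_ne h.1 h.2 hx, D.projEnd_of_ne h.1 h.2 (D.invariant γ x hx), map_zero]
  exact LinearMap.congr_fun this x

theorem sum_projEnd : ∑ α, D.projEnd α α = 1 := by
  refine D.ext_blocks fun γ x hx => ?_
  rw [LinearMap.sum_apply, Finset.sum_eq_single γ]
  · rw [D.projEnd_of_mem γ γ (D.le_pair_left _ _ hx), Module.End.one_apply]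
  · exact fun α _ h => D.projEnd_of_ne h.symm h.symm hx
  · exact fun h => absurd (Finset.mem_univ _) h

/-! ### The block operators on the whole space -/

/-- As the projection commutes with A, the restricted operator can be replaced by A itself, and all
later computations take place on V. -/
theorem blockOp_eq (α β : Fin D.s) (X : Module.End ℝ V) :
    D.blockOp α β X = polyDeriv (minpoly ℝ (D.pairOp α β)) A
      (D.projEnd α β * X * D.projEnd α β) := by
  have hpow : ∀ (j : ℕ) (y : D.pair α β), ((D.pairOp α β ^ j) y : V) = (A ^ j) (y : V) :=
    fun j y => by
      have := aeval_restrict_apply (D.pair_invariant α β) (Polynomial.X ^ j) y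
      rwa [map_pow, map_pow, aeval_X, aeval_X] at this
  have hcomm : ∀ (j : ℕ) (y : V), D.projEnd α β ((A ^ j) y) = (A ^ j) (D.projEnd α β y) :=
    fun j y => by
      have := commute_aeval (D.projEnd_comm α β) (Polynomial.X ^ j) y
      rwa [map_pow, aeval_X] at this
  ext x
  have h : D.blockOp α β X x =
      (D.pair α β).subtype (polyDeriv (minpoly ℝ (D.pairOp α β)) (D.pairOp α β)
        (D.compress α β X) (D.proj α β x)) := rfl
  rw [h, polyDeriv_apply, polyDeriv_apply]
  simp only [LinearMap.sum_apply, LinearMap.smul_apply, map_sum, map_smul, Module.End.mul_apply]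
  refine Finset.sum_congr rfl fun m _ => ?_
  congr 1
  refine Finset.sum_congr rfl fun j _ => ?_
  rw [hcomm, Submodule.subtype_apply, hpow, compress_apply, hpow]
  rfl

theorem formalCurvature_apply (hA : g.IsSelfAdjoint A) (X : so g) :
    (D.formalCurvature hA X : Module.End ℝ V) =
      ∑ p : Fin D.s × Fin D.s with p.1 ≤ p.2, D.blockOp p.1 p.2 X := by
  have h := map_sum (so g).toSubmodule.subtype
    (fun p : Fin D.s × Fin D.s => D.blockCurvature hA p.1 p.2 X)
    (Finset.univ.filter fun p => p.1 ≤ p.2)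
  rw [← LinearMap.sum_apply] at h
  exact h

theorem isFormalCurvatureTensor (hg : g.IsSymm) (hA : g.IsSelfAdjoint A) :
    IsFormalCurvatureTensor
      ((so g).toSubmodule.subtype ∘ₗ D.formalCurvature hA ∘ₗ wedgeToSo g hg) := by
  intro u v w
  have h : ∀ x y, ((so g).toSubmodule.subtype ∘ₗ D.formalCurvature hA ∘ₗ wedgeToSo g hg)
      (exteriorPower.ιMulti ℝ 2 ![x, y]) =
      ∑ p : Fin D.s × Fin D.s with p.1 ≤ p.2, D.blockOp p.1 p.2 (wedgeOp g x y) := by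
    intro x y
    rw [← wedgeToSo_wedge g hg, ← D.formalCurvature_apply hA]
    rfl
  rw [h, h, h, LinearMap.sum_apply, LinearMap.sum_apply, LinearMap.sum_apply,
    ← Finset.sum_add_distrib, ← Finset.sum_add_distrib]
  refine Finset.sum_eq_zero fun p _ => ?_
  rw [blockOp_eq, blockOp_eq, blockOp_eq]
  exact polyDeriv_bianchi hg hA _ (D.form_projEnd p.1 p.2) (D.projEnd_comm p.1 p.2) u v w

theorem aeval_minpoly_apply {α β : Fin D.s} {x : V} (hx : x ∈ D.pair α β) :
    aeval A (minpoly ℝ (D.pairOp α β)) x = 0 := by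
  have h := aeval_restrict_apply (D.pair_invariant α β) (minpoly ℝ (D.pairOp α β)) ⟨x, hx⟩
  rw [← h]
  change ((aeval (D.pairOp α β) (minpoly ℝ (D.pairOp α β)) ⟨x, hx⟩ : D.pair α β) : V) = 0
  rw [minpoly.aeval]
  rfl

theorem blockOp_comm (α β : Fin D.s) (X : Module.End ℝ V) (x : V) :
    D.blockOp α β X (A x) = A (D.blockOp α β X x) := by
  have h := polyDeriv_mul_sub_mul (minpoly ℝ (D.pairOp α β)) A
    (D.projEnd α β * X * D.projEnd α β)
  have h1 : (D.projEnd α β * X * D.projEnd α β) * aeval A (minpoly ℝ (D.pairOp α β)) = 0 := by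
    ext y
    simp only [Module.End.mul_apply, LinearMap.zero_apply]
    rw [commute_aeval (D.projEnd_comm α β), D.aeval_minpoly_apply (D.projEnd_mem α β y), map_zero,
      map_zero]
  have h2 : aeval A (minpoly ℝ (D.pairOp α β)) * (D.projEnd α β * X * D.projEnd α β) = 0 := by
    ext y
    exact D.aeval_minpoly_apply (D.projEnd_mem α β _)
  rw [h1, h2, sub_zero, sub_eq_zero, ← D.blockOp_eq] at h
  exact LinearMap.congr_fun h x

theorem formalCurvature_mem_centraliser (hA : g.IsSelfAdjoint A) (X : so g) :
    (D.formalCurvature hA X : Module.End ℝ V) ∈ centraliser g A := by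
  refine mem_centraliser.2 ⟨(D.formalCurvature hA X).2, fun x => ?_⟩
  rw [formalCurvature_apply, LinearMap.sum_apply, LinearMap.sum_apply, map_sum]
  exact Finset.sum_congr rfl fun p _ => D.blockOp_comm p.1 p.2 X x

theorem projEnd_wedgeOp (α β : Fin D.s) (w z : V) :
    D.projEnd α β * wedgeOp g w z * D.projEnd α β =
      wedgeOp g (D.projEnd α β w) (D.projEnd α β z) := by
  ext x
  simp [wedgeOp_apply, form_projEnd]

theorem minpoly_pairOp_comm (α β : Fin D.s) :
    minpoly ℝ (D.pairOp α β) = minpoly ℝ (D.pairOp β α) := by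
  have h : ∀ (U U' : Submodule ℝ V) (hU : ∀ x ∈ U, A x ∈ U) (hU' : ∀ x ∈ U', A x ∈ U'),
      U = U' → minpoly ℝ (A.restrict hU) = minpoly ℝ (A.restrict hU') := by
    rintro U _ hU hU' rfl
    rfl
  exact h _ _ _ _ (sup_comm _ _)

theorem blockOp_wedgeOp (α β : Fin D.s) {w z : V} (hw : w ∈ D.pair α β) (hz : z ∈ D.pair α β) :
    D.blockOp α β (wedgeOp g w z) = polyDeriv (minpoly ℝ (D.pairOp α β)) A (wedgeOp g w z) := by
  rw [blockOp_eq, projEnd_wedgeOp, D.projEnd_of_mem α β hw, D.projEnd_of_mem α β hz]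

theorem blockOp_wedgeOp_of_ne {α β : Fin D.s} {w z : V} (hw : w ∈ D.W α) (hz : z ∈ D.W β)
    {γ δ : Fin D.s} (h : (α ≠ γ ∧ α ≠ δ) ∨ (β ≠ γ ∧ β ≠ δ)) :
    D.blockOp γ δ (wedgeOp g w z) = 0 := by
  rw [blockOp_eq, projEnd_wedgeOp]
  have h0 : wedgeOp g (D.projEnd γ δ w) (D.projEnd γ δ z) = 0 := by
    rcases h with h | h
    · rw [D.projEnd_of_ne h.1 h.2 hw]
      ext x
      simp [wedgeOp_apply]
    · rw [D.projEnd_of_ne h.1 h.2 hz]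
      ext x
      simp [wedgeOp_apply]
  rw [h0, map_zero]

/-- The compression of w ∧ z to V_γ + V_δ is the wedge of the projections, so for α ≠ β only the
summand of the unordered pair {α, β} sees it. The sum runs over ordered indices, whence the two
cases. -/
theorem formalCurvature_wedgeOp (hg : g.IsSymm) (hA : g.IsSelfAdjoint A) {α β : Fin D.s}
    (hαβ : α ≠ β) {w z : V} (hw : w ∈ D.W α) (hz : z ∈ D.W β) :
    (D.formalCurvature hA ⟨wedgeOp g w z, wedgeOp_mem_so g hg w z⟩ : Module.End ℝ V) =
      polyDeriv (minpoly ℝ (D.pairOp α β)) A (wedgeOp g w z) := by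
  rw [formalCurvature_apply]
  rcases le_total α β with hle | hle
  · rw [Finset.sum_eq_single (α, β)]
    · exact D.blockOp_wedgeOp α β (D.le_pair_left _ _ hw) (D.le_pair_right _ _ hz)
    · rintro ⟨γ, δ⟩ hp hne
      refine D.blockOp_wedgeOp_of_ne hw hz ?_
      simp only [Finset.mem_filter, Finset.mem_univ, true_and, ne_eq, Prod.mk.injEq] at hp hne ⊢
      grind
    · intro h
      exact absurd (by simpa using hle) h
  · rw [Finset.sum_eq_single (β, α), D.minpoly_pairOp_comm]
    · exact D.blockOp_wedgeOp β α (D.le_pair_right _ _ hw) (D.le_pair_left _ _ hz)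
    · rintro ⟨γ, δ⟩ hp hne
      refine D.blockOp_wedgeOp_of_ne hw hz ?_
      simp only [Finset.mem_filter, Finset.mem_univ, true_and, ne_eq, Prod.mk.injEq] at hp hne ⊢
      grind
    · intro h
      exact absurd (by simpa using hle) h

/-! ### The image of the formal curvature tensor -/

theorem exists_generator (α : Fin D.s) :
    ∃ f n v, IsPrimaryVector A f n v ∧ D.W α = LinearMap.range (evalAt A v) := by
  obtain ⟨f, n, u, h, hr⟩ := (D.isJordanBlock α).exists_isPrimaryVector
  refine ⟨f, n, u, h.of_restrict, le_antisymm (fun x hx => ?_)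
    (range_evalAt_le (D.invariant α) u.2)⟩
  obtain ⟨q, hq⟩ := LinearMap.range_eq_top.1 hr ⟨x, hx⟩
  refine ⟨q, ?_⟩
  rw [evalAt_apply, ← aeval_restrict_apply (D.invariant α), ← evalAt_apply, hq]

variable {D} in
theorem aeval_pow_apply {α : Fin D.s} {f : ℝ[X]} {n : ℕ} {v : V} (h : IsPrimaryVector A f n v)
    (hα : D.W α = LinearMap.range (evalAt A v)) {m : ℕ} (hm : n ≤ m) {x : V} (hx : x ∈ D.W α) :
    aeval A (f ^ m) x = 0 := by
  rw [hα] at hx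
  obtain ⟨q, rfl⟩ := hx
  rw [← evalAt_mul, h.ker]
  exact (pow_dvd_pow f hm).mul_right q

variable {D} in
-- The higher power f^n kills both blocks, and no proper divisor of it kills v.
theorem minpoly_pairOp_eq [FiniteDimensional ℝ V] {α β : Fin D.s} {f : ℝ[X]} {n m : ℕ} {u v : V}
    (hu : IsPrimaryVector A f m u) (hα : D.W α = LinearMap.range (evalAt A u))
    (hv : IsPrimaryVector A f n v) (hβ : D.W β = LinearMap.range (evalAt A v)) (hmn : m ≤ n) :
    minpoly ℝ (D.pairOp α β) = f ^ n := by
  refine eq_of_monic_of_associated (minpoly.monic (Algebra.IsIntegral.isIntegral _))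
    (hv.monic.pow n) (associated_of_dvd_dvd (minpoly.dvd ℝ _ ?_) ?_)
  · ext ⟨x, hx⟩
    obtain ⟨y, hy, z, hz, rfl⟩ := Submodule.mem_sup.1 hx
    change ((aeval (A.restrict (D.pair_invariant α β)) (f ^ n) ⟨y + z, hx⟩ : D.pair α β) : V) = 0
    rw [aeval_restrict_apply, map_add, aeval_pow_apply hu hα hmn hy,
      aeval_pow_apply hv hβ le_rfl hz, add_zero]
  · rw [← hv.ker]
    exact D.aeval_minpoly_apply (D.le_pair_right _ _ (hβ ▸ self_mem_range_evalAt A v))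

/-- An element of the centraliser interchanging two blocks belonging to the same irreducible
polynomial, and vanishing on the others, is a value of the formal curvature tensor. -/
theorem exists_formalCurvature_eq [FiniteDimensional ℝ V] (hg : g.IsSymm) (hnd : g.Nondegenerate)
    (hA : g.IsSelfAdjoint A) {α β : Fin D.s} (hαβ : α ≠ β) {f : ℝ[X]} {n m : ℕ} {u v : V}
    (hu : IsPrimaryVector A f m u) (hα : D.W α = LinearMap.range (evalAt A u))
    (hv : IsPrimaryVector A f n v) (hβ : D.W β = LinearMap.range (evalAt A v)) (hmn : m ≤ n)
    {Z : Module.End ℝ V} (hZ : Z ∈ centraliser g A) (hZα : ∀ x ∈ D.W α, Z x ∈ D.W β)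
    (hZβ : ∀ x ∈ D.W β, Z x ∈ D.W α) (hZ0 : ∀ γ, γ ≠ α → γ ≠ β → ∀ x ∈ D.W γ, Z x = 0) :
    ∃ X, (D.formalCurvature hA X : Module.End ℝ V) = Z := by
  obtain ⟨hZso, hZA⟩ := mem_centraliser.1 hZ
  have hvβ : v ∈ D.W β := hβ ▸ self_mem_range_evalAt A v
  have hAj : ∀ γ (j : ℕ), ∀ x ∈ D.W γ, (A ^ j) x ∈ D.W γ := fun γ j x hx => by
    have h := aeval_restrict_apply (D.invariant γ) (X ^ j) ⟨x, hx⟩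
    rw [map_pow, map_pow, aeval_X, aeval_X] at h
    rw [← h]
    exact Subtype.property _
  obtain ⟨z₀, h1, h0⟩ := hv.exists_dual_vector hnd
  -- Projecting the dual vector into V_β preserves its pairings with the A^j v, which lie in V_β.
  have hz₀ : ∀ j, g (D.projEnd β β z₀) ((A ^ j) v) = g z₀ ((A ^ j) v) := fun j => by
    rw [form_projEnd, D.projEnd_of_mem β β (D.le_pair_left _ _ (hAj β j v hvβ))]
  set z := D.projEnd β β z₀
  have hz : z ∈ D.W β := D.projEnd_self_mem β z₀
  have hw : Z v ∈ D.W α := hZβ v hvβ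
  have hp := minpoly_pairOp_eq hu hα hv hβ hmn
  have hR := D.formalCurvature_wedgeOp hg hA hαβ hw hz
  rw [hp] at hR
  refine ⟨⟨wedgeOp g (Z v) z, wedgeOp_mem_so g hg _ _⟩, ?_⟩
  set L := D.formalCurvature hA ⟨wedgeOp g (Z v) z, wedgeOp_mem_so g hg (Z v) z⟩
  obtain ⟨hLso, hLA⟩ := mem_centraliser.1 (D.formalCurvature_mem_centraliser hA
    ⟨wedgeOp g (Z v) z, wedgeOp_mem_so g hg (Z v) z⟩)
  have hLx : ∀ x, (L : Module.End ℝ V) x = ∑ k ∈ (f ^ n).support, (f ^ n).coeff k •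
      ∑ j ∈ Finset.range k, (g z ((A ^ j) x) • (A ^ (k - 1 - j)) (Z v) -
        g (Z v) ((A ^ j) x) • (A ^ (k - 1 - j)) z) := fun x => by
    rw [hR, polyDeriv_wedgeOp_apply]
  have hLv : (L : Module.End ℝ V) v = Z v := by
    rw [hR]
    refine polyDeriv_wedgeOp_apply_of_dual (hv.monic.pow n)
      (fun j => D.orthogonal α β hαβ _ hw _ (hAj β j v hvβ)) ?_ (fun j hj => ?_) ?_
    · rw [hz₀, h1]
    · rw [hz₀, h0 j hj]
    · rw [natDegree_pow]
      exact Nat.mul_pos hv.pos hv.irreducible.natDegree_pos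
  have hLβ : ∀ x ∈ D.W β, (L : Module.End ℝ V) x = Z x := by
    rw [hβ]
    rintro _ ⟨q, rfl⟩
    rw [evalAt_apply, commute_aeval hLA, commute_aeval hZA, hLv]
  have hL0 : ∀ γ, γ ≠ α → γ ≠ β → ∀ x ∈ D.W γ, (L : Module.End ℝ V) x = 0 := by
    intro γ h1 h2 x hx
    rw [hLx]
    refine Finset.sum_eq_zero fun k _ => ?_
    rw [Finset.sum_eq_zero fun j _ => ?_, smul_zero]
    rw [D.orthogonal β γ h2.symm z hz _ (hAj γ j x hx),
      D.orthogonal α γ h1.symm _ hw _ (hAj γ j x hx), zero_smul, zero_smul, sub_zero]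
  have hLα : ∀ x ∈ D.W α, (L : Module.End ℝ V) x ∈ D.W β := by
    intro x hx
    rw [hLx]
    refine Submodule.sum_mem _ fun k _ => Submodule.smul_mem _ _ (Submodule.sum_mem _ fun j _ => ?_)
    rw [D.orthogonal β α hαβ.symm z hz _ (hAj α j x hx), zero_smul, zero_sub]
    exact neg_mem (Submodule.smul_mem _ _ (hAj β _ z hz))
  rw [mem_so] at hZso hLso
  refine D.ext_blocks fun γ x hx => ?_
  by_cases hγβ : γ = β
  · subst hγβ
    exact hLβ x hx
  by_cases hγα : γ = α
  · subst hγα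
    rw [← sub_eq_zero]
    refine hnd.1 _ fun y => ?_
    -- Both L and Z map V_α into V_β, so only pairings with V_β matter; there skewness reduces the
    -- claim to the equality already known on V_β.
    have hy : g ((L : Module.End ℝ V) x - Z x) = 0 := by
      refine D.ext_blocks fun δ y hy => ?_
      rw [LinearMap.zero_apply]
      by_cases hδ : δ = β
      · subst hδ
        rw [map_sub, LinearMap.sub_apply, hLso, hZso, hLβ y hy, sub_self]
      · exact D.orthogonal β δ (Ne.symm hδ) _ (sub_mem (hLα x hx) (hZα x hx)) y hy
    rw [hy, LinearMap.zero_apply]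
  · rw [hL0 γ hγα hγβ x hx, hZ0 γ hγα hγβ x hx]

/-- An operator commuting with a cyclic one is a polynomial in it, hence self-adjoint; being skew as
well, it vanishes. -/
theorem projEnd_mul_mul_projEnd_self_eq_zero (hnd : g.Nondegenerate)
    (hA : g.IsSelfAdjoint A) {Y : Module.End ℝ V} (hY : Y ∈ centraliser g A) (α : Fin D.s) :
    D.projEnd α α * Y * D.projEnd α α = 0 := by
  obtain ⟨hYso, hYA⟩ := mem_centraliser.1 hY
  rw [mem_so] at hYso
  set T := D.projEnd α α * Y * D.projEnd α α with hT
  have hTx : ∀ x, T x = D.projEnd α α (Y (D.projEnd α α x)) := fun _ => rfl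
  have hTA : ∀ x, T (A x) = A (T x) := fun x => by
    rw [hTx, hTx, projEnd_comm, hYA, projEnd_comm]
  have hTso : ∀ x y, g (T x) y = -g x (T y) := fun x y => by
    rw [hTx, hTx, form_projEnd, hYso, form_projEnd]
  have hTα : ∀ x, T x ∈ D.W α := fun x => D.projEnd_self_mem α _
  obtain ⟨f, n, v, -, hv⟩ := D.exists_generator α
  obtain ⟨q, hq⟩ : T v ∈ LinearMap.range (evalAt A v) := hv ▸ hTα v
  have hTq : ∀ x ∈ D.W α, T x = aeval A q x := by
    rw [hv]
    rintro _ ⟨r, rfl⟩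
    rw [evalAt_apply, commute_aeval hTA, ← hq, evalAt_apply, ← Module.End.mul_apply,
      ← Module.End.mul_apply, ← map_mul, ← map_mul, mul_comm]
  refine D.ext_blocks fun γ x hx => ?_
  by_cases hγ : γ = α
  · subst hγ
    refine hnd.1 _ fun y => ?_
    have hy : g (T x) = 0 := by
      refine D.ext_blocks fun δ y hy => ?_
      by_cases hδ : δ = γ
      · subst hδ
        have h1 := hTso x y
        rw [hTq x hx, hTq y hy, ← form_aeval hA] at h1
        rw [hTq x hx, LinearMap.zero_apply]
        linarith
      · exact D.orthogonal γ δ (Ne.symm hδ) _ (hTα x) y hy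
    rw [hy, LinearMap.zero_apply]
  · rw [hTx, D.projEnd_of_ne hγ hγ hx, map_zero, map_zero, LinearMap.zero_apply]

/-- Values of the block are killed by both f^m and f'^n, which are coprime. -/
theorem projEnd_mul_mul_projEnd_eq_zero {α β : Fin D.s} {f f' : ℝ[X]} {n m : ℕ} {u v : V}
    (hu : IsPrimaryVector A f m u) (hα : D.W α = LinearMap.range (evalAt A u))
    (hv : IsPrimaryVector A f' n v) (hβ : D.W β = LinearMap.range (evalAt A v)) (hff : f ≠ f')
    {Y : Module.End ℝ V} (hYA : ∀ x, Y (A x) = A (Y x)) :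
    D.projEnd α α * Y * D.projEnd β β = 0 := by
  have hcop : IsCoprime (f ^ m) (f' ^ n) := by
    refine IsCoprime.pow (hu.irreducible.coprime_iff_not_dvd.2 fun h => hff ?_)
    exact eq_of_monic_of_associated hu.monic hv.monic
      (hu.irreducible.associated_of_dvd hv.irreducible h)
  obtain ⟨a, b, hab⟩ := hcop
  set T := D.projEnd α α * Y * D.projEnd β β
  have hTx : ∀ x, T x = D.projEnd α α (Y (D.projEnd β β x)) := fun _ => rfl
  have hTA : ∀ x, T (A x) = A (T x) := fun x => by
    rw [hTx, hTx, projEnd_comm, hYA, projEnd_comm]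
  refine D.ext_blocks fun γ x hx => ?_
  rw [LinearMap.zero_apply]
  by_cases hγ : γ = β
  · subst hγ
    have h1 : aeval A (f ^ m) (T x) = 0 := aeval_pow_apply hu hα le_rfl (D.projEnd_self_mem α _)
    have h2 : aeval A (f' ^ n) (T x) = 0 := by
      rw [← commute_aeval hTA, aeval_pow_apply hv hβ le_rfl hx, map_zero]
    calc T x = aeval A (a * f ^ m + b * f' ^ n) (T x) := by rw [hab, map_one, Module.End.one_apply]
      _ = 0 := by
        rw [map_add, map_mul, map_mul, LinearMap.add_apply, Module.End.mul_apply _ _ (T x),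
          Module.End.mul_apply _ _ (T x), h1, h2, map_zero, map_zero, add_zero]
  · rw [hTx, D.projEnd_of_ne hγ hγ hx, map_zero, map_zero]

/-- A single off-diagonal block is not skew in general; adding the opposite block restores skewness
and keeps commutation with A. -/
theorem symm_block_mem_range [FiniteDimensional ℝ V] (hg : g.IsSymm) (hnd : g.Nondegenerate)
    (hA : g.IsSelfAdjoint A) {Y : Module.End ℝ V} (hY : Y ∈ centraliser g A) (α β : Fin D.s) :
    D.projEnd α α * Y * D.projEnd β β + D.projEnd β β * Y * D.projEnd α α ∈
      (LinearMap.range (D.formalCurvature hA)).map (so g).toSubmodule.subtype := by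
  obtain ⟨hYso, hYA⟩ := mem_centraliser.1 hY
  rw [mem_so] at hYso
  by_cases hαβ : α = β
  · subst hαβ
    rw [D.projEnd_mul_mul_projEnd_self_eq_zero hnd hA hY, add_zero]
    exact Submodule.zero_mem _
  obtain ⟨f, m, u, hu, hα⟩ := D.exists_generator α
  obtain ⟨f', n, v, hv, hβ⟩ := D.exists_generator β
  by_cases hff : f = f'
  · subst hff
    set Z := D.projEnd α α * Y * D.projEnd β β + D.projEnd β β * Y * D.projEnd α α
    have hZx : ∀ x, Z x = D.projEnd α α (Y (D.projEnd β β x)) +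
      D.projEnd β β (Y (D.projEnd α α x)) := fun _ => rfl
    have hZ : Z ∈ centraliser g A := by
      refine mem_centraliser.2 ⟨(mem_so g Z).2 fun x y => ?_, fun x => ?_⟩
      · rw [hZx, hZx, map_add, map_add, LinearMap.add_apply, form_projEnd, hYso, form_projEnd,
          form_projEnd, hYso, form_projEnd]
        ring
      · rw [hZx, hZx, map_add, projEnd_comm, hYA, projEnd_comm, projEnd_comm, hYA, projEnd_comm]
    have hZα : ∀ x ∈ D.W α, Z x ∈ D.W β := fun x hx => by
      rw [hZx, D.projEnd_of_ne hαβ hαβ hx, map_zero, map_zero, zero_add]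
      exact D.projEnd_self_mem β _
    have hZβ : ∀ x ∈ D.W β, Z x ∈ D.W α := fun x hx => by
      rw [hZx, D.projEnd_of_ne (Ne.symm hαβ) (Ne.symm hαβ) hx, map_zero, map_zero, add_zero]
      exact D.projEnd_self_mem α _
    have hZ0 : ∀ γ, γ ≠ α → γ ≠ β → ∀ x ∈ D.W γ, Z x = 0 := fun γ h1 h2 x hx => by
      rw [hZx, D.projEnd_of_ne h1 h1 hx, D.projEnd_of_ne h2 h2 hx, map_zero, map_zero, map_zero,
        add_zero]
    obtain ⟨X, hX⟩ : ∃ X, (D.formalCurvature hA X : Module.End ℝ V) = Z := by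
      rcases le_total m n with h | h
      · exact D.exists_formalCurvature_eq hg hnd hA hαβ hu hα hv hβ h hZ hZα hZβ hZ0
      · exact D.exists_formalCurvature_eq hg hnd hA (Ne.symm hαβ) hv hβ hu hα h hZ hZβ hZα
          fun γ h1 h2 => hZ0 γ h2 h1
    exact ⟨_, ⟨X, rfl⟩, hX⟩
  · rw [D.projEnd_mul_mul_projEnd_eq_zero hu hα hv hβ hff hYA,
      D.projEnd_mul_mul_projEnd_eq_zero hv hβ hu hα (Ne.symm hff) hYA, add_zero]
    exact Submodule.zero_mem _

theorem map_range_formalCurvature [FiniteDimensional ℝ V] (hg : g.IsSymm) (hnd : g.Nondegenerate)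
    (hA : g.IsSelfAdjoint A) :
    (LinearMap.range (D.formalCurvature hA)).map (so g).toSubmodule.subtype =
      (centraliser g A).toSubmodule := by
  refine le_antisymm ?_ fun Y hY => ?_
  · rintro _ ⟨_, ⟨X, rfl⟩, rfl⟩
    exact D.formalCurvature_mem_centraliser hA X
  · have hsum : ∑ α, ∑ β, (D.projEnd α α * Y * D.projEnd β β +
        D.projEnd β β * Y * D.projEnd α α) = (2 : ℝ) • Y := by
      simp only [Finset.sum_add_distrib, ← Finset.mul_sum, ← Finset.sum_mul, D.sum_projEnd,
        mul_one, one_mul]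
      rw [two_smul]
    have hmem := Submodule.sum_mem _ fun α (_ : α ∈ Finset.univ) =>
      Submodule.sum_mem _ fun β (_ : β ∈ Finset.univ) =>
        D.symm_block_mem_range hg hnd hA hY α β
    rw [hsum] at hmem
    have := Submodule.smul_mem _ (2⁻¹ : ℝ) hmem
    rwa [smul_smul, inv_mul_cancel₀ two_ne_zero, one_smul] at this

end JordanDecomposition

/-! ### ### The Berger property and the main theorem -/

/-- A single tensor with full image suffices, since the decomposable bivectors span Λ²V. -/
theorem isBerger_of_range_eq {V : Type*} [AddCommGroup V] [Module ℝ V]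
    {h : LieSubalgebra ℝ (Module.End ℝ V)} {R : ⋀[ℝ]^2 V →ₗ[ℝ] Module.End ℝ V}
    (hR : IsFormalCurvatureTensor R) (hrange : LinearMap.range R = h.toSubmodule) :
    IsBerger h := by
  refine le_antisymm ?_ (Submodule.span_le.2 ?_)
  · have hspan : h.toSubmodule =
        Submodule.span ℝ (R '' Set.range (exteriorPower.ιMulti ℝ 2 (M := V))) := by
      rw [← hrange, LinearMap.range_eq_map, ← exteriorPower.ιMulti_span ℝ 2 V, Submodule.map_span]
    refine hspan.le.trans (Submodule.span_mono ?_)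
    rintro _ ⟨_, ⟨m, rfl⟩, rfl⟩
    refine ⟨R, hR, hrange.le, m 0, m 1, ?_⟩
    rw [show ![m 0, m 1] = m from List.ofFn_inj.1 rfl]
  · rintro _ ⟨R', -, hR', u, v, rfl⟩
    exact hR' ⟨_, rfl⟩

end BergerTest

theorem mainTheorem6 {V : Type*} [AddCommGroup V] [Module ℝ V] [FiniteDimensional ℝ V]
    (g : LinearMap.BilinForm ℝ V) (hg : g.IsSymm) (hnd : g.Nondegenerate)
    (A : Module.End ℝ V) (hA : g.IsSelfAdjoint A) :
    Nonempty (BergerTest.JordanDecomposition g A) ∧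
    (∀ D : BergerTest.JordanDecomposition g A,
      BergerTest.IsFormalCurvatureTensor
        ((BergerTest.so g).toSubmodule.subtype ∘ₗ D.formalCurvature hA ∘ₗ
          BergerTest.wedgeToSo g hg) ∧
      (LinearMap.range (D.formalCurvature hA)).map (BergerTest.so g).toSubmodule.subtype =
        (BergerTest.centraliser g A).toSubmodule) ∧
    BergerTest.IsBerger (BergerTest.centraliser g A) := by
  have hD := BergerTest.nonempty_jordanDecomposition hg hnd hA
  refine ⟨hD, fun D => ⟨D.isFormalCurvatureTensor hg hA,
    D.map_range_formalCurvature hg hnd hA⟩, ?_⟩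
  obtain ⟨D⟩ := hD
  refine BergerTest.isBerger_of_range_eq (D.isFormalCurvatureTensor hg hA) ?_
  rw [LinearMap.range_comp, LinearMap.range_comp_of_range_eq_top _
    (LinearMap.range_eq_top.2 (BergerTest.wedgeToSo_bijective g hg hnd).2)]
  exact D.map_range_formalCurvature hg hnd hA
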